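/- Conventions. Hilbert spaces are complex, $\langle\cdot,\cdot\rangle$ is linear in the first entry, and $\otimes$ between Hilbert spaces is the Hilbert space tensor product (the obvious identifications, such as $\mathbb C\otimes\mathcal H=\mathcal H$, changing the order of the factors, and associativity, are made tacitly). Let $\Lambda$ be a set and let $K:\Lambda\times\Lambda\to\mathbb{C}$ be a (complete) Pick kernel: $K$ is positive definite, nowhere zero, and for every $\lambda_0\in\Lambda$ the function $(\mu,\lambda)\mapsto 1-\frac{K(\mu,\lambda_0)K(\lambda_0,\lambda)}{K(\mu,\lambda)K(\lambda_0,\lambda_0)}$ is positive definite. Let $\mathfrak H(K)$ be its reproducing kernel Hilbert space, $k_\lambda(\mu)=K(\mu,\lambda)$, fix $\lambda_0\in\Lambda$, put $\delta=k_{\lambda_0}/\|k_{\lambda_0}\|$, and assume that $K$ is normalized at $\lambda_0$, that is, $\delta\equiv 1$. Let $\pi$ be the orthogonal projection of $\mathfrak H(K)$ onto $\mathbb{C}\delta$ (the constant functions). Let $\mathcal B$ be a Hilbert space and let $\beta:\Lambda\to\mathcal B$ have values in the open unit ball, with $$K(\mu,\lambda)=\frac{\delta(\mu)\overline{\delta(\lambda)}}{1-\langle\beta(\lambda),\beta(\mu)\rangle}\quad(\mu,\lambda\in\Lambda),\qquad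 \overline{\operatorname{span}}\{\beta(\lambda):\lambda\in\Lambda\}=\mathcal B.$$ For Hilbert spaces $\mathcal G',\mathcal G$, a function $G:\Lambda\to\mathcal L(\mathcal G',\mathcal G)$ is a contractive multiplier if $\xi\otimes k_\lambda\mapsto G(\lambda)^*\xi\otimes k_\lambda$ extends to a contraction $\mathcal G\otimes\mathfrak H(K)\to\mathcal G'\otimes\mathfrak H(K)$; the adjoint of this contraction is denoted by $\mathfrak m_G$, and $\mathcal M_G$ is the range of $\mathfrak m_G$ with the norm $\|x\|_{\mathcal M_G}=\inf\{\|y\|:\mathfrak m_G y=x\}$. Let $\boldsymbol B=\mathfrak m_B:\mathcal B\otimes\mathfrak H(K)\to\mathfrak H(K)$ be the operator of the contractive multiplier $B(\lambda)\xi=\langle\xi,\beta(\lambda)\rangle$, so that $\boldsymbol B^*k_\lambda=\beta(\lambda)\otimes k_\lambda$. A Hilbert space $\mathcal H'$ is contractively included in a Hilbert space $\mathcal H$ if it is a vector subspace of $\mathcal H$ and $\|x\|_{\mathcal H}\le\|x\|_{\mathcal H'}$ for $x\in\mathcal H'$. Its complementary subspace $\mathcal H'^\sharp$ is the unique Hilbert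 space $\mathcal H''$ contractively included in $\mathcal H$ such that (a) $\|x'+x''\|_{\mathcal H}^2\le\|x'\|_{\mathcal H'}^2+\|x''\|_{\mathcal H''}^2$ for all $x'\in\mathcal H'$, $x''\in\mathcal H''$, and (b) every $x\in\mathcal H$ has a unique decomposition $x=x'+x''$ with $x'\in\mathcal H'$, $x''\in\mathcal H''$ and $\|x\|_{\mathcal H}^2=\|x'\|_{\mathcal H'}^2+\|x''\|_{\mathcal H''}^2$. Theorem. Let $\mathcal G$ be a Hilbert space and let $\mathcal N$ be a Hilbert space contractively included in $\mathfrak H(K)\otimes\mathcal G$. The following are equivalent. (i) There exist a Hilbert space $\mathcal G'$ and a contractive multiplier $G:\Lambda\to\mathcal L(\mathcal G',\mathcal G)$ such that $\mathcal N=\mathcal M_G^\sharp$ (with equality of norms). (ii) There exists a contraction $\tilde{\boldsymbol B}:\mathcal N\to\mathcal B\otimes\mathcal N$ such that for every $\xi\in\mathcal N$ $$\xi=(\boldsymbol B\otimes I_{\mathcal G})\tilde{\boldsymbol B}\xi+(\pi\otimes I_{\mathcal G})\xi,$$ $$\|\tilde{\boldsymbol B}\xi\|^2_{\mathcal B\otimes\mathcal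 N}\le\|\xi\|^2_{\mathcal N}-\|(\pi\otimes I_{\mathcal G})\xi\|^2_{\mathfrak H(K)\otimes\mathcal G}.$$ Moreover, if $\mathcal N$ is isometrically included in $\mathfrak H(K)\otimes\mathcal G$, then every $\tilde{\boldsymbol B}$ as in (ii) equals $(\boldsymbol B^*\otimes I_{\mathcal G})|_{\mathcal N}$ (where $\mathcal B\otimes\mathcal N$ is regarded as a subspace of $\mathcal B\otimes\mathfrak H(K)\otimes\mathcal G$). -/

import Mathlib

open scoped TensorProduct ComplexOrder ComplexConjugate

universe uB uG uN

noncomputable section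

/-! ## Hilbert space tensor products -/

section HilbertTensor

variable {E F G E' F' : Type*}
  [NormedAddCommGroup E] [InnerProductSpace ℂ E]
  [NormedAddCommGroup F] [InnerProductSpace ℂ F]
  [NormedAddCommGroup G] [InnerProductSpace ℂ G]
  [NormedAddCommGroup E'] [InnerProductSpace ℂ E']
  [NormedAddCommGroup F'] [InnerProductSpace ℂ F']

/-- The Hilbert space tensor product: the completion of the algebraic tensor product with respect
to the inner product `⟪x ⊗ y, x' ⊗ y'⟫ = ⟪x, x'⟫ * ⟪y, y'⟫`. -/
def HilbertTensor (E F : Type*) [NormedAddCommGroup E] [InnerProductSpace ℂ E]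
    [NormedAddCommGroup F] [InnerProductSpace ℂ F] : Type _ :=
  UniformSpace.Completion (E ⊗[ℂ] F)

infixr:100 " ⊗ₕ " => HilbertTensor

instance HilbertTensor.instNormedAddCommGroup : NormedAddCommGroup (E ⊗ₕ F) :=
  inferInstanceAs (NormedAddCommGroup (UniformSpace.Completion (E ⊗[ℂ] F)))

instance HilbertTensor.instInnerProductSpace : InnerProductSpace ℂ (E ⊗ₕ F) :=
  inferInstanceAs (InnerProductSpace ℂ (UniformSpace.Completion (E ⊗[ℂ] F)))

instance HilbertTensor.instCompleteSpace : CompleteSpace (E ⊗ₕ F) :=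
  inferInstanceAs (CompleteSpace (UniformSpace.Completion (E ⊗[ℂ] F)))

/-- The isometric inclusion of the algebraic tensor product. -/
def HilbertTensor.incl (E F : Type*) [NormedAddCommGroup E] [InnerProductSpace ℂ E]
    [NormedAddCommGroup F] [InnerProductSpace ℂ F] : E ⊗[ℂ] F →ₗᵢ[ℂ] E ⊗ₕ F :=
  (UniformSpace.Completion.toComplₗᵢ :
    E ⊗[ℂ] F →ₗᵢ[ℂ] UniformSpace.Completion (E ⊗[ℂ] F))

theorem HilbertTensor.denseRange_incl : DenseRange (HilbertTensor.incl E F) :=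
  UniformSpace.Completion.denseRange_coe (α := E ⊗[ℂ] F)

/-- The simple tensor `x ⊗ y` in the Hilbert space tensor product. -/
def htmul (x : E) (y : F) : E ⊗ₕ F := HilbertTensor.incl E F (x ⊗ₜ[ℂ] y)

/-- The continuous extension to `E ⊗ₕ F` of an operator on the algebraic tensor product. -/
def HilbertTensor.lift {W : Type*} [NormedAddCommGroup W] [InnerProductSpace ℂ W] [CompleteSpace W]
    (f : E ⊗[ℂ] F →L[ℂ] W) : E ⊗ₕ F →L[ℂ] W :=
  (f.fromCompletion : UniformSpace.Completion (E ⊗[ℂ] F) →L[ℂ] W)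

theorem HilbertTensor.lift_incl {W : Type*} [NormedAddCommGroup W] [InnerProductSpace ℂ W]
    [CompleteSpace W] (f : E ⊗[ℂ] F →L[ℂ] W) (z : E ⊗[ℂ] F) :
    HilbertTensor.lift f (HilbertTensor.incl E F z) = f z :=
  f.fromCompletion_apply_coe z

/-- The operator `f ⊗ g` between Hilbert space tensor products. -/
def hmap (f : E →L[ℂ] E') (g : F →L[ℂ] F') : E ⊗ₕ F →L[ℂ] E' ⊗ₕ F' :=
  HilbertTensor.lift
    ((HilbertTensor.incl E' F').toContinuousLinearMap ∘L TensorProduct.mapL f g)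

theorem hmap_htmul (f : E →L[ℂ] E') (g : F →L[ℂ] F') (x : E) (y : F) :
    hmap f g (htmul x y) = htmul (f x) (g y) := by
  simp [hmap, htmul, HilbertTensor.lift_incl]

/-- The flip `x ⊗ y ↦ y ⊗ x`. -/
def hswap (E F : Type*) [NormedAddCommGroup E] [InnerProductSpace ℂ E]
    [NormedAddCommGroup F] [InnerProductSpace ℂ F] : E ⊗ₕ F →L[ℂ] F ⊗ₕ E :=
  HilbertTensor.lift ((HilbertTensor.incl F E).comp
    (TensorProduct.commIsometry ℂ E F).toLinearIsometry).toContinuousLinearMap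

theorem hswap_htmul (x : E) (y : F) : hswap E F (htmul x y) = htmul y x := by
  simp [hswap, htmul, HilbertTensor.lift_incl]

/-- The identification of `ℂ ⊗ E` with `E`. -/
def hlid (E : Type*) [NormedAddCommGroup E] [InnerProductSpace ℂ E] [CompleteSpace E] :
    ℂ ⊗ₕ E →L[ℂ] E :=
  HilbertTensor.lift (TensorProduct.lidIsometry ℂ E).toLinearIsometry.toContinuousLinearMap

theorem hlid_htmul [CompleteSpace E] (c : ℂ) (x : E) : hlid E (htmul c x) = c • x := by
  simp [hlid, htmul, HilbertTensor.lift_incl]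

theorem inner_htmul (x x' : E) (y y' : F) :
    inner ℂ (htmul x y) (htmul x' y') = inner ℂ x x' * inner ℂ y y' := by
  simp [htmul]

theorem smul_htmul (a : ℂ) (x : E) (y : F) : htmul (a • x) y = a • htmul x y := by
  rw [htmul, ← TensorProduct.smul_tmul', map_smul, htmul]

theorem htmul_smul (a : ℂ) (x : E) (y : F) : htmul x (a • y) = a • htmul x y := by
  rw [htmul, TensorProduct.tmul_smul, map_smul, htmul]

/-- A closed subspace of `E ⊗ₕ F` that contains all simple tensors is everything. -/
theorem HilbertTensor.eq_top (S : Submodule ℂ (E ⊗ₕ F)) (hS : IsClosed (S : Set (E ⊗ₕ F)))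
    (h : ∀ (x : E) (y : F), htmul x y ∈ S) : S = ⊤ := by
  rw [eq_top_iff]
  rintro z -
  refine HilbertTensor.denseRange_incl.induction_on (p := fun z ↦ z ∈ S) z hS fun z ↦ ?_
  induction z using TensorProduct.induction_on with
  | zero => simp
  | tmul x y => exact h x y
  | add a b ha hb =>
    rw [map_add]
    exact S.add_mem ha hb

theorem HilbertTensor.ext_inner_htmul {u v : E ⊗ₕ F}
    (h : ∀ (x : E) (y : F), inner ℂ u (htmul x y) = inner ℂ v (htmul x y)) : u = v := by
  have hS := HilbertTensor.eq_top (LinearMap.ker (innerSL ℂ (u - v)).toLinearMap)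
    (innerSL ℂ (u - v)).isClosed_ker
    (fun x y ↦ by
      change inner ℂ (u - v) (htmul x y) = 0
      rw [inner_sub_left, h x y, sub_self])
  have h0 : u - v ∈ LinearMap.ker (innerSL ℂ (u - v)).toLinearMap := hS ▸ Submodule.mem_top
  exact sub_eq_zero.mp (inner_self_eq_zero.mp h0)

theorem continuous_htmul_left (y : F) : Continuous fun x : E ↦ htmul x y :=
  (HilbertTensor.incl E F).continuous.comp
    (TensorProduct.continuous_tmul.comp (by fun_prop : Continuous fun x : E ↦ (x, y)))

theorem continuous_htmul_right (x : E) : Continuous fun y : F ↦ htmul x y :=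
  (HilbertTensor.incl E F).continuous.comp
    (TensorProduct.continuous_tmul.comp (by fun_prop : Continuous fun y : F ↦ (x, y)))

/-- The inclusion of the algebraic tensor product into `(E ⊗ F) ⊗ G`. -/
def tripleLeft (E F G : Type*) [NormedAddCommGroup E] [InnerProductSpace ℂ E]
    [NormedAddCommGroup F] [InnerProductSpace ℂ F] [NormedAddCommGroup G]
    [InnerProductSpace ℂ G] : (E ⊗[ℂ] F) ⊗[ℂ] G →ₗᵢ[ℂ] (E ⊗ₕ F) ⊗ₕ G :=
  (HilbertTensor.incl (E ⊗ₕ F) G).comp ((HilbertTensor.incl E F).rTensor G)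

/-- The inclusion of the algebraic tensor product into `E ⊗ (F ⊗ G)`. -/
def tripleRight (E F G : Type*) [NormedAddCommGroup E] [InnerProductSpace ℂ E]
    [NormedAddCommGroup F] [InnerProductSpace ℂ F] [NormedAddCommGroup G]
    [InnerProductSpace ℂ G] : E ⊗[ℂ] (F ⊗[ℂ] G) →ₗᵢ[ℂ] E ⊗ₕ (F ⊗ₕ G) :=
  (HilbertTensor.incl E (F ⊗ₕ G)).comp ((HilbertTensor.incl F G).lTensor E)

theorem tripleLeft_tmul (x : E) (y : F) (z : G) :
    tripleLeft E F G ((x ⊗ₜ y) ⊗ₜ z) = htmul (htmul x y) z := by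
  simp [tripleLeft, htmul]

theorem tripleRight_tmul (x : E) (y : F) (z : G) :
    tripleRight E F G (x ⊗ₜ (y ⊗ₜ z)) = htmul x (htmul y z) := by
  simp [tripleRight, htmul]

theorem norm_tripleRight_assoc (x : (E ⊗[ℂ] F) ⊗[ℂ] G) :
    ‖(tripleRight E F G).toLinearMap (TensorProduct.assoc ℂ E F G x)‖ =
      ‖(tripleLeft E F G).toLinearMap x‖ := by
  have h := (TensorProduct.assocIsometry ℂ E F G).norm_map x
  rw [TensorProduct.assocIsometry_apply] at h
  exact ((tripleRight E F G).norm_map _).trans (h.trans ((tripleLeft E F G).norm_map x).symm)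

theorem denseRange_tripleLeft : DenseRange (tripleLeft E F G).toLinearMap := by
  have h := HilbertTensor.eq_top
    (LinearMap.range (tripleLeft E F G).toLinearMap).topologicalClosure
    (Submodule.isClosed_topologicalClosure _) (fun w z ↦ by
      refine HilbertTensor.denseRange_incl.induction_on (p := fun w ↦ htmul w z ∈
        (LinearMap.range (tripleLeft E F G).toLinearMap).topologicalClosure) w
        ((Submodule.isClosed_topologicalClosure _).preimage (continuous_htmul_left z)) fun w ↦ ?_
      apply Submodule.le_topologicalClosure
      exact ⟨w ⊗ₜ z, by simp [tripleLeft, htmul]⟩)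
  rw [DenseRange, ← LinearMap.coe_range]
  exact Submodule.dense_iff_topologicalClosure_eq_top.mpr h

theorem denseRange_tripleRight : DenseRange (tripleRight E F G).toLinearMap := by
  have h := HilbertTensor.eq_top
    (LinearMap.range (tripleRight E F G).toLinearMap).topologicalClosure
    (Submodule.isClosed_topologicalClosure _) (fun x w ↦ by
      refine HilbertTensor.denseRange_incl.induction_on (p := fun w ↦ htmul x w ∈
        (LinearMap.range (tripleRight E F G).toLinearMap).topologicalClosure) w
        ((Submodule.isClosed_topologicalClosure _).preimage (continuous_htmul_right x)) fun w ↦ ?_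
      apply Submodule.le_topologicalClosure
      exact ⟨x ⊗ₜ w, by simp [tripleRight, htmul]⟩)
  rw [DenseRange, ← LinearMap.coe_range]
  exact Submodule.dense_iff_topologicalClosure_eq_top.mpr h

/-- The identification `(x ⊗ y) ⊗ z ↦ x ⊗ (y ⊗ z)`. -/
def hassoc (E F G : Type*) [NormedAddCommGroup E] [InnerProductSpace ℂ E]
    [NormedAddCommGroup F] [InnerProductSpace ℂ F] [NormedAddCommGroup G]
    [InnerProductSpace ℂ G] : (E ⊗ₕ F) ⊗ₕ G ≃ₗᵢ[ℂ] E ⊗ₕ (F ⊗ₕ G) :=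
  (TensorProduct.assoc ℂ E F G).extendOfIsometry
    (tripleLeft E F G).toLinearMap (tripleRight E F G).toLinearMap
    denseRange_tripleLeft denseRange_tripleRight norm_tripleRight_assoc

theorem hassoc_htmul (x : E) (y : F) (z : G) :
    hassoc E F G (htmul (htmul x y) z) = htmul x (htmul y z) := by
  have h := LinearEquiv.extendOfIsometry_eq (TensorProduct.assoc ℂ E F G)
    (tripleLeft E F G).toLinearMap (tripleRight E F G).toLinearMap
    denseRange_tripleLeft denseRange_tripleRight norm_tripleRight_assoc ((x ⊗ₜ y) ⊗ₜ z)
  simp only [LinearIsometry.coe_toLinearMap, TensorProduct.assoc_tmul, tripleLeft_tmul,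
    tripleRight_tmul] at h
  exact h

end HilbertTensor

/-! ## Contractively included subspaces -/

section ContractiveInclusion

variable {M N W : Type*}
  [NormedAddCommGroup M] [InnerProductSpace ℂ M]
  [NormedAddCommGroup N] [InnerProductSpace ℂ N]
  [NormedAddCommGroup W] [InnerProductSpace ℂ W]

/-- `ι` exhibits `N` as a contractively included subspace of `W`: it is an injective
contraction. -/
structure IsContractiveInclusion (ι : N →L[ℂ] W) : Prop where
  injective : Function.Injective ι
  norm_le : ∀ x, ‖ι x‖ ≤ ‖x‖

/-- The norm of the range space of `C`: for `x` in the range of `C`, the infimum of `‖y‖` over all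
`y` with `C y = x`. -/
def rangeNorm (C : M →L[ℂ] W) (x : W) : ℝ := sInf {r : ℝ | ∃ y : M, C y = x ∧ ‖y‖ = r}

/-- The contractively included subspace `ι : N → W` is the complementary subspace of the range space
of the contraction `C` (that is, of the range of `C` with the norm `rangeNorm C`). -/
structure IsComplementOfRange (C : M →L[ℂ] W) (ι : N →L[ℂ] W) : Prop where
  norm_add_sq_le : ∀ x ∈ Set.range C, ∀ y : N, ‖x + ι y‖ ^ 2 ≤ rangeNorm C x ^ 2 + ‖y‖ ^ 2
  existsUnique_decomposition : ∀ w : W, ∃! p : W × N,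
    p.1 ∈ Set.range C ∧ w = p.1 + ι p.2 ∧ ‖w‖ ^ 2 = rangeNorm C p.1 ^ 2 + ‖p.2‖ ^ 2

end ContractiveInclusion

/-! ## Pick kernels -/

/-- A positive definite kernel on `Λ`: all the finite matrices `K (l i) (l j)` are positive
semidefinite. -/
def IsPosDefKernel {Λ : Type*} (K : Λ → Λ → ℂ) : Prop := (Matrix.of K).PosSemidef

/-- A (complete) Pick kernel. Nonvanishing of `K` is what makes the quotient meaningful. -/
structure IsPickKernel {Λ : Type*} (K : Λ → Λ → ℂ) : Prop where
  posDef : IsPosDefKernel K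
  ne_zero : ∀ m l, K m l ≠ 0
  pick : ∀ o : Λ, IsPosDefKernel fun m l ↦ 1 - K m o * K o l / (K m l * K o o)

section RKHS

variable {Λ : Type*} (H : Type*) [NormedAddCommGroup H] [InnerProductSpace ℂ H] [CompleteSpace H]
  [RKHS ℂ H Λ ℂ]

/-- `H` is the reproducing kernel Hilbert space of the scalar kernel `K`. -/
def HasKernel (K : Λ → Λ → ℂ) : Prop := ∀ m l, RKHS.kernel H m l 1 = K m l

/-- The reproducing vector `k_l`, that is the function `m ↦ K m l`. -/
def repKer (l : Λ) : H := RKHS.kerFun H l 1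

/-- The normalized reproducing vector `δ = k_o / ‖k_o‖` at the base point `o`. -/
def normalizedKer (o : Λ) : H := ((‖repKer H o‖⁻¹ : ℝ) : ℂ) • repKer H o

/-- The kernel is normalized at the base point `o`: the function `δ` is identically `1`. -/
def IsNormalizedAt (o : Λ) : Prop := ∀ l : Λ, normalizedKer H o l = 1

/-- The orthogonal projection `π` of `H` onto the span of `δ` (the constant functions, if the kernel
is normalized at `o`). -/
def baseProj (o : Λ) : H →L[ℂ] H := (ℂ ∙ normalizedKer H o).starProjection

end RKHS

/-- The representation `K (m, l) = δ(m) conj(δ(l)) / (1 - ⟨β(l), β(m)⟩)`, where `⟨·,·⟩` is linear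
in the first entry, with `B` the closed span of the values of `β`, which lie in the open unit
ball. -/
structure IsPickRepresentation {Λ B : Type*} [NormedAddCommGroup B] [InnerProductSpace ℂ B]
    (K : Λ → Λ → ℂ) (δ : Λ → ℂ) (β : Λ → B) : Prop where
  norm_lt_one : ∀ l, ‖β l‖ < 1
  kernel_eq : ∀ m l, K m l = δ m * conj (δ l) / (1 - inner ℂ (β m) (β l))
  minimal : (Submodule.span ℂ (Set.range β)).topologicalClosure = ⊤

/-! ## Multipliers -/

section Multipliers

variable {Λ : Type*} (H : Type*) [NormedAddCommGroup H] [InnerProductSpace ℂ H] [CompleteSpace H]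
  [RKHS ℂ H Λ ℂ]
  {G G' : Type*} [NormedAddCommGroup G] [InnerProductSpace ℂ G] [CompleteSpace G]
  [NormedAddCommGroup G'] [InnerProductSpace ℂ G'] [CompleteSpace G']

/-- `T` extends the densely defined operator `ξ ⊗ k_l ↦ Φ(l)^* ξ ⊗ k_l`. -/
def IsMultiplierAdjoint (Φ : Λ → G' →L[ℂ] G) (T : G ⊗ₕ H →L[ℂ] G' ⊗ₕ H) : Prop :=
  ∀ (l : Λ) (ξ : G), T (htmul ξ (repKer H l)) =
    htmul (ContinuousLinearMap.adjoint (Φ l) ξ) (repKer H l)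

/-- `Φ` is a multiplier. -/
def IsMultiplier (Φ : Λ → G' →L[ℂ] G) : Prop :=
  ∃ T : G ⊗ₕ H →L[ℂ] G' ⊗ₕ H, IsMultiplierAdjoint H Φ T

/-- `Φ` is a contractive multiplier. -/
def IsContractiveMultiplier (Φ : Λ → G' →L[ℂ] G) : Prop :=
  ∃ T : G ⊗ₕ H →L[ℂ] G' ⊗ₕ H, IsMultiplierAdjoint H Φ T ∧ ‖T‖ ≤ 1

open Classical in
/-- The operator `𝔪_Φ : G' ⊗ H → G ⊗ H` of a multiplier `Φ`, which is defined through its adjoint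
(and is `0` if `Φ` is not a multiplier). -/
def multOp (Φ : Λ → G' →L[ℂ] G) : G' ⊗ₕ H →L[ℂ] G ⊗ₕ H :=
  if h : IsMultiplier H Φ then ContinuousLinearMap.adjoint h.choose else 0

theorem adjoint_multOp {Φ : Λ → G' →L[ℂ] G} (h : IsMultiplier H Φ) (l : Λ) (ξ : G) :
    ContinuousLinearMap.adjoint (multOp H Φ) (htmul ξ (repKer H l)) =
      htmul (ContinuousLinearMap.adjoint (Φ l) ξ) (repKer H l) := by
  rw [multOp, dif_pos h, ContinuousLinearMap.adjoint_adjoint]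
  exact h.choose_spec l ξ

/-- The operator `𝔪_Φ`, read as an operator `G' ⊗ H → H ⊗ G`. -/
def multOpSwap (Φ : Λ → G' →L[ℂ] G) : G' ⊗ₕ H →L[ℂ] H ⊗ₕ G :=
  hswap G H ∘L multOp H Φ

end Multipliers

section PickOperators

variable {Λ : Type*} (H : Type*) [NormedAddCommGroup H] [InnerProductSpace ℂ H] [CompleteSpace H]
  [RKHS ℂ H Λ ℂ]
  {B : Type*} [NormedAddCommGroup B] [InnerProductSpace ℂ B] [CompleteSpace B]

/-- The function `B(l) ξ = ⟨ξ, β(l)⟩` (linear in `ξ`). -/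
def pickFun (β : Λ → B) (l : Λ) : B →L[ℂ] ℂ := innerSL ℂ (β l)

/-- The operator `𝐁 = 𝔪_B : B ⊗ H → H`. -/
def pickOp (β : Λ → B) : B ⊗ₕ H →L[ℂ] H := hlid H ∘L multOp H (pickFun β)

/-- In a Pick representation, `B` is a contractive multiplier, so that `𝐁` really is the operator
with `𝐁^* k_l = β(l) ⊗ k_l`. -/
theorem isContractiveMultiplier_pickFun {K : Λ → Λ → ℂ} (hH : HasKernel H K) {δ : Λ → ℂ}
    {β : Λ → B} (hβ : IsPickRepresentation K δ β) : IsContractiveMultiplier H (pickFun β) := by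
  have hk : ∀ i j, inner ℂ (repKer H i) (repKer H j) = K i j := fun i j ↦ by
    rw [repKer, RKHS.kerFun_inner, repKer, RKHS.kerFun_apply, hH i j]
    simp
  have hne : ∀ i j, 1 - inner ℂ (β i) (β j) ≠ 0 := fun i j h ↦ by
    have h1 : ‖inner ℂ (β i) (β j)‖ ≤ ‖β i‖ * ‖β j‖ := norm_inner_le_norm _ _
    rw [← sub_eq_zero.mp h, norm_one] at h1
    nlinarith [hβ.norm_lt_one i, hβ.norm_lt_one j, norm_nonneg (β i), norm_nonneg (β j)]
  have hd : ∀ i j, K i j - inner ℂ (β i) (β j) * K i j = δ i * conj (δ j) := fun i j ↦ by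
    rw [hβ.kernel_eq i j]
    field_simp [hne i j]
  let e : (Λ →₀ ℂ) →ₗ[ℂ] ℂ ⊗ₕ H :=
    Finsupp.linearCombination ℂ fun l ↦ htmul (1 : ℂ) (repKer H l)
  let f : (Λ →₀ ℂ) →ₗ[ℂ] B ⊗ₕ H := Finsupp.linearCombination ℂ fun l ↦ htmul (β l) (repKer H l)
  have he : ∀ c, inner ℂ (e c) (e c) = c.sum fun i a ↦ c.sum fun j b ↦ conj a * b * K i j := by
    intro c
    simp only [e, Finsupp.linearCombination_apply, Finsupp.sum]
    rw [sum_inner]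
    refine Finset.sum_congr rfl fun i _ ↦ ?_
    rw [inner_sum]
    refine Finset.sum_congr rfl fun j _ ↦ ?_
    rw [inner_smul_left, inner_smul_right, inner_htmul, hk]
    simp
    ring
  have hf : ∀ c, inner ℂ (f c) (f c) =
      c.sum fun i a ↦ c.sum fun j b ↦ conj a * b * (inner ℂ (β i) (β j) * K i j) := by
    intro c
    simp only [f, Finsupp.linearCombination_apply, Finsupp.sum]
    rw [sum_inner]
    refine Finset.sum_congr rfl fun i _ ↦ ?_
    rw [inner_sum]
    refine Finset.sum_congr rfl fun j _ ↦ ?_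
    rw [inner_smul_left, inner_smul_right, inner_htmul, hk]
    ring
  have hb : ∀ c, ‖f c‖ ≤ 1 * ‖e c‖ := by
    intro c
    have h : inner ℂ (e c) (e c) - inner ℂ (f c) (f c) =
        (c.sum fun i a ↦ conj a * δ i) * conj (c.sum fun i a ↦ conj a * δ i) := by
      rw [he, hf]
      simp only [Finsupp.sum, map_sum, Finset.sum_mul_sum, ← Finset.sum_sub_distrib, ← mul_sub, hd]
      refine Finset.sum_congr rfl fun i _ ↦ Finset.sum_congr rfl fun j _ ↦ ?_
      simp
      ring
    rw [Complex.mul_conj, inner_self_eq_norm_sq_to_K, inner_self_eq_norm_sq_to_K] at h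
    have h2 : ‖e c‖ ^ 2 - ‖f c‖ ^ 2 = Complex.normSq (c.sum fun i a ↦ conj a * δ i) := by
      refine Complex.ofReal_injective ?_
      rw [Complex.ofReal_sub, Complex.ofReal_pow, Complex.ofReal_pow]
      exact h
    rw [one_mul]
    refine (sq_le_sq₀ (norm_nonneg _) (norm_nonneg _)).mp ?_
    linarith [Complex.normSq_nonneg (c.sum fun i a ↦ conj a * δ i)]
  have hdense : DenseRange e := by
    rw [DenseRange, ← LinearMap.coe_range]
    refine Submodule.dense_iff_topologicalClosure_eq_top.mpr
      (HilbertTensor.eq_top _ (Submodule.isClosed_topologicalClosure _) fun a x ↦ ?_)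
    rw [← mul_one a, ← smul_eq_mul, smul_htmul]
    refine Submodule.smul_mem _ a ?_
    have hx : x ∈ closure (Submodule.span ℂ {RKHS.kerFun H l v | (l) (v)} : Set H) := by
      rw [← Submodule.topologicalClosure_coe, RKHS.kerFun_dense H]
      trivial
    refine closure_minimal (t := {x | htmul (1 : ℂ) x ∈ (LinearMap.range e).topologicalClosure})
      (fun y hy ↦ ?_)
      ((Submodule.isClosed_topologicalClosure _).preimage (continuous_htmul_right 1)) hx
    refine Submodule.le_topologicalClosure _ ?_
    refine Submodule.span_induction (p := fun y _ ↦ htmul (1 : ℂ) y ∈ LinearMap.range e)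
      ?_ ?_ ?_ ?_ hy
    · rintro _ ⟨l, v, rfl⟩
      refine ⟨Finsupp.single l v, ?_⟩
      have hv : RKHS.kerFun H l v = v • repKer H l := by
        rw [repKer, ← map_smul, smul_eq_mul, mul_one]
      rw [hv, htmul_smul]
      simp [e]
    · exact ⟨0, by simp [htmul]⟩
    · rintro y z - - hy hz
      simpa only [htmul, TensorProduct.tmul_add, map_add] using add_mem hy hz
    · rintro a y - hy
      rw [htmul_smul]
      exact Submodule.smul_mem _ a hy
  refine ⟨f.extendOfNorm e, fun l ξ ↦ ?_, ?_⟩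
  · have h1 : htmul ξ (repKer H l) = e (Finsupp.single l ξ) := by
      simp [e, ← smul_htmul]
    have h2 : ContinuousLinearMap.adjoint (pickFun β l) ξ = ξ • β l := by
      refine ext_inner_right ℂ fun w ↦ ?_
      rw [ContinuousLinearMap.adjoint_inner_left]
      simp [pickFun, inner_smul_left, mul_comm]
    rw [h1, LinearMap.extendOfNorm_eq hdense ⟨1, hb⟩, h2]
    simp [f, smul_htmul]
  · exact ContinuousLinearMap.opNorm_le_bound _ zero_le_one
      (LinearMap.norm_extendOfNorm_apply_le hdense _ hb)

theorem adjoint_pickOp_repKer {K : Λ → Λ → ℂ} (hH : HasKernel H K) {δ : Λ → ℂ}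
    {β : Λ → B} (hβ : IsPickRepresentation K δ β) (l : Λ) :
    ContinuousLinearMap.adjoint (pickOp H β) (repKer H l) = htmul (β l) (repKer H l) := by
  obtain ⟨T, hT, -⟩ := isContractiveMultiplier_pickFun H hH hβ
  have h1 : ContinuousLinearMap.adjoint (hlid H) (repKer H l) = htmul 1 (repKer H l) := by
    refine HilbertTensor.ext_inner_htmul fun a x ↦ ?_
    rw [ContinuousLinearMap.adjoint_inner_left, hlid_htmul, inner_htmul, inner_smul_right]
    simp
  have h2 : ContinuousLinearMap.adjoint (pickFun β l) 1 = β l := by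
    refine ext_inner_right ℂ fun w ↦ ?_
    rw [ContinuousLinearMap.adjoint_inner_left]
    simp [pickFun]
  rw [pickOp, ContinuousLinearMap.adjoint_comp, ContinuousLinearMap.comp_apply, h1,
    adjoint_multOp H ⟨T, hT⟩, h2]

variable (G : Type*) [NormedAddCommGroup G] [InnerProductSpace ℂ G] [CompleteSpace G]

/-- The operator `𝐁 ⊗ I_G : B ⊗ (H ⊗ G) → H ⊗ G`. -/
def pickOpTensor (β : Λ → B) : B ⊗ₕ (H ⊗ₕ G) →L[ℂ] H ⊗ₕ G :=
  hmap (pickOp H β) (ContinuousLinearMap.id ℂ G) ∘L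
    ((hassoc B H G).symm.toContinuousLinearEquiv : B ⊗ₕ (H ⊗ₕ G) →L[ℂ] (B ⊗ₕ H) ⊗ₕ G)

/-- The operator `𝐁^* ⊗ I_G : H ⊗ G → B ⊗ (H ⊗ G)`. -/
def pickOpAdjointTensor (β : Λ → B) : H ⊗ₕ G →L[ℂ] B ⊗ₕ (H ⊗ₕ G) :=
  ((hassoc B H G).toContinuousLinearEquiv : (B ⊗ₕ H) ⊗ₕ G →L[ℂ] B ⊗ₕ (H ⊗ₕ G)) ∘L
    hmap (ContinuousLinearMap.adjoint (pickOp H β)) (ContinuousLinearMap.id ℂ G)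

/-- The operator `π ⊗ I_G`. -/
def baseProjTensor (o : Λ) : H ⊗ₕ G →L[ℂ] H ⊗ₕ G :=
  hmap (baseProj H o) (ContinuousLinearMap.id ℂ G)

variable {G} {N : Type*} [NormedAddCommGroup N] [InnerProductSpace ℂ N] [CompleteSpace N]

/-- `Bt : N → B ⊗ N` is a contraction such that every `ξ` in `N` satisfies the identity
`ξ = (𝐁 ⊗ I) Bt ξ + (π ⊗ I) ξ` and the inequality for difference quotients. Here `N` is a
contractively included subspace of `H ⊗ G` through `ι`, so `B ⊗ N` is mapped to `B ⊗ (H ⊗ G)`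
by `I ⊗ ι`. -/
structure IsDifferenceQuotient (o : Λ) (β : Λ → B) (ι : N →L[ℂ] H ⊗ₕ G)
    (Bt : N →L[ℂ] B ⊗ₕ N) : Prop where
  contraction : ‖Bt‖ ≤ 1
  eq_add : ∀ ξ : N, ι ξ =
    pickOpTensor H G β (hmap (ContinuousLinearMap.id ℂ B) ι (Bt ξ)) + baseProjTensor H G o (ι ξ)
  norm_sq_le : ∀ ξ : N, ‖Bt ξ‖ ^ 2 ≤ ‖ξ‖ ^ 2 - ‖baseProjTensor H G o (ι ξ)‖ ^ 2

end PickOperators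

end

/-! ### Contractions: factorization, defect operators, extension from Gram data. -/

section HilbertOperators

variable {E F N Z W M : Type*}
  [NormedAddCommGroup E] [InnerProductSpace ℂ E] [CompleteSpace E]
  [NormedAddCommGroup F] [InnerProductSpace ℂ F] [CompleteSpace F]
  [NormedAddCommGroup N] [InnerProductSpace ℂ N] [CompleteSpace N]
  [NormedAddCommGroup Z] [InnerProductSpace ℂ Z] [CompleteSpace Z]
  [NormedAddCommGroup W] [InnerProductSpace ℂ W] [CompleteSpace W]
  [NormedAddCommGroup M] [InnerProductSpace ℂ M] [CompleteSpace M]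

/-! Write `C` for the operator of the multiplier, `𝐁` also for `𝐁 ⊗ I`, `Q g = δ ⊗ g`, so that `π ⊗
I = Q Q^*`. Everything is moved to adjoints: `N` is complementary to the range of `C` exactly when
`C C^* + ι ι^* = I` (`isComplementOfRange_of_norm_sq`, `IsComplementOfRange.norm_sq`). Normalization
gives `𝐁 𝐁^* + Q Q^* = I`.

Both directions compare `ι^*` with the column `L w = ((I ⊗ ι^*) 𝐁^* w, Q^* w)` (`pickColumn`). The
identity in (ii) says `L^* (Bt, Q^* ι) = ι`, and the norm inequality says that `(Bt, Q^* ι)` is a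
contraction. So (ii) amounts to a contractive factorization of `ι^*` through `L`, and by Douglas'
lemma to `ι ι^* ≤ L^* L`.

From (i), this inequality reduces to `‖(I ⊗ C^*) 𝐁^* w‖ ≤ ‖C^* w‖`, which holds because `𝐁^*`
commutes with adjoints of multipliers. From (ii), a defect operator yields `F` with `F^* F = L^* L -
ι ι^*`. On vectors `k_l ⊗ g` the form of `F^* F` is that of `I` on `G` minus `1 - ⟨β(l), β(m)⟩`
times that of `ι ι^*`. Multiplication by `K` turns this into the form of `I - ι ι^*`, so `Φ(l)^* g =
F (k_l ⊗ g)` is the required multiplier.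

For isometric `ι`, `(I ⊗ ι) Bt ξ` and `𝐁^* ι ξ` have the same image under `𝐁`; the norm bound forces
the first to be the preimage of least norm, which is the second. -/

omit [CompleteSpace W] in
/-- Douglas' factorization lemma. -/
theorem exists_contraction_comp_eq (A : W →L[ℂ] N) (L : W →L[ℂ] Z) (h : ∀ w, ‖A w‖ ≤ ‖L w‖) :
    ∃ T : Z →L[ℂ] N, (∀ z, ‖T z‖ ≤ ‖z‖) ∧ ∀ w, T (L w) = A w := by
  let Y := (LinearMap.range L.toLinearMap).topologicalClosure
  let e : W →ₗ[ℂ] Y := L.toLinearMap.codRestrict Y fun w ↦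
    Submodule.le_topologicalClosure _ ⟨w, rfl⟩
  have hb : ∀ w, ‖A.toLinearMap w‖ ≤ 1 * ‖e w‖ := fun w ↦ by
    rw [one_mul]
    exact h w
  have hdense : DenseRange e := by
    intro y
    rw [closure_subtype]
    have : ((↑) : Y → Z) '' Set.range e = LinearMap.range L.toLinearMap := by
      ext z
      simp [e]
    rw [this]
    exact y.2
  -- `T` is determined on the closure of the range of `L` and is set to zero on its orthogonal
  -- complement.
  refine ⟨(A.toLinearMap.extendOfNorm e) ∘L Y.orthogonalProjectionOnto, fun z ↦ ?_, fun w ↦ ?_⟩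
  · refine (LinearMap.norm_extendOfNorm_apply_le hdense _ hb _).trans ?_
    rw [one_mul]
    exact Y.norm_orthogonalProjectionOnto_apply_le z
  · have : Y.orthogonalProjectionOnto (L w) = e w :=
      Y.orthogonalProjectionOnto_mem_subspace_eq_self (e w)
    rw [ContinuousLinearMap.comp_apply, this, LinearMap.extendOfNorm_eq hdense ⟨1, hb⟩]
    rfl

/-- Take the positive square root of `I - A^* A`, which is positive because `A` is a contraction. -/
theorem exists_defect_operator (A : E →L[ℂ] N) (h : ∀ x, ‖A x‖ ≤ ‖x‖) :
    ∃ S : E →L[ℂ] E, ∀ x y, inner ℂ (S x) (S y) = inner ℂ x y - inner ℂ (A x) (A y) := by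
  set D : E →L[ℂ] E := ContinuousLinearMap.id ℂ E - ContinuousLinearMap.adjoint A ∘L A with hD
  have hpos : 0 ≤ D := by
    rw [ContinuousLinearMap.nonneg_iff_isPositive, ContinuousLinearMap.isPositive_def']
    refine ⟨?_, fun x ↦ ?_⟩
    · rw [hD]
      refine (IsSelfAdjoint.one _).sub ?_
      rw [ContinuousLinearMap.isSelfAdjoint_iff', ContinuousLinearMap.adjoint_comp,
        ContinuousLinearMap.adjoint_adjoint]
    · rw [ContinuousLinearMap.reApplyInnerSelf_apply, hD, sub_apply, inner_sub_left,
        ContinuousLinearMap.comp_apply, ContinuousLinearMap.adjoint_inner_left, map_sub,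
        ContinuousLinearMap.id_apply, inner_self_eq_norm_sq, inner_self_eq_norm_sq]
      nlinarith [h x, norm_nonneg (A x)]
  refine ⟨CFC.sqrt D, fun x y ↦ ?_⟩
  have hs : ContinuousLinearMap.adjoint (CFC.sqrt D) = CFC.sqrt D :=
    (CFC.sqrt_nonneg D).isSelfAdjoint
  have hm : CFC.sqrt D (CFC.sqrt D x) = D x :=
    congrArg (fun T : E →L[ℂ] E ↦ T x) (CFC.sqrt_mul_sqrt_self D hpos)
  rw [← ContinuousLinearMap.adjoint_inner_left, hs, hm, hD, sub_apply,
    inner_sub_left, ContinuousLinearMap.comp_apply, ContinuousLinearMap.adjoint_inner_left]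
  rfl

-- By sesquilinearity the Gram identity passes to linear combinations, where it bounds the image by
-- the argument. This makes `u i ↦ v i` well defined on the span even when the `u i` are dependent,
-- and the norm identity survives passage to the closure.
omit [CompleteSpace E] [CompleteSpace N] in
theorem exists_extension_of_inner_eq {I : Type*} (u : I → E) (v : I → F) (A : E →L[ℂ] N)
    (hu : (Submodule.span ℂ (Set.range u)).topologicalClosure = ⊤)
    (h : ∀ i j, inner ℂ (v i) (v j) = inner ℂ (u i) (u j) - inner ℂ (A (u i)) (A (u j))) :
    ∃ T : E →L[ℂ] F, (∀ i, T (u i) = v i) ∧ ∀ x, ‖T x‖ ^ 2 + ‖A x‖ ^ 2 = ‖x‖ ^ 2 := by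
  let e := Finsupp.linearCombination ℂ u
  let f := Finsupp.linearCombination ℂ v
  have hinner : ∀ c d, inner ℂ (f c) (f d) = inner ℂ (e c) (e d) - inner ℂ (A (e c)) (A (e d)) := by
    intro c d
    induction c using Finsupp.induction_linear with
    | zero => simp
    | add c c' hc hc' =>
      simp only [map_add, inner_add_left, hc, hc']
      ring
    | single i a =>
      induction d using Finsupp.induction_linear with
      | zero => simp
      | add d d' hd hd' =>
        simp only [map_add, inner_add_right, hd, hd']
        ring
      | single j b =>
        simp only [e, f, Finsupp.linearCombination_single, map_smul, inner_smul_left,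
          inner_smul_right, h]
        ring
  have hnorm : ∀ c, ‖f c‖ ^ 2 + ‖A (e c)‖ ^ 2 = ‖e c‖ ^ 2 := fun c ↦ by
    have := congrArg Complex.re (hinner c c)
    rw [Complex.sub_re] at this
    have h1 := inner_self_eq_norm_sq (𝕜 := ℂ) (f c)
    have h2 := inner_self_eq_norm_sq (𝕜 := ℂ) (e c)
    have h3 := inner_self_eq_norm_sq (𝕜 := ℂ) (A (e c))
    simp only [RCLike.re_to_complex] at h1 h2 h3
    linarith
  have hb : ∀ c, ‖f c‖ ≤ 1 * ‖e c‖ := fun c ↦ by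
    rw [one_mul]
    refine (sq_le_sq₀ (norm_nonneg _) (norm_nonneg _)).mp ?_
    nlinarith [hnorm c, sq_nonneg ‖A (e c)‖]
  have hdense : DenseRange e := by
    rw [DenseRange, ← LinearMap.coe_range, Finsupp.range_linearCombination]
    exact Submodule.dense_iff_topologicalClosure_eq_top.mpr hu
  have hext : ∀ c, f.extendOfNorm e (e c) = f c := LinearMap.extendOfNorm_eq hdense ⟨1, hb⟩
  refine ⟨f.extendOfNorm e, fun i ↦ ?_, fun x ↦ ?_⟩
  · have := hext (Finsupp.single i 1)
    simpa [e, f] using this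
  · refine hdense.induction_on
      (p := fun x ↦ ‖f.extendOfNorm e x‖ ^ 2 + ‖A x‖ ^ 2 = ‖x‖ ^ 2) x
      (isClosed_eq (by fun_prop) (by fun_prop)) fun c ↦ ?_
    rw [hext, hnorm]

/-! ### Complementary range spaces as an operator identity. -/

theorem re_inner_adjoint_comp_self (A : E →L[ℂ] F) (x : E) :
    RCLike.re (inner ℂ x (ContinuousLinearMap.adjoint A (A x))) = ‖A x‖ ^ 2 := by
  rw [ContinuousLinearMap.adjoint_inner_right, inner_self_eq_norm_sq]

theorem adjoint_comp_add_eq_id {A : E →L[ℂ] F} {A' : E →L[ℂ] N}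
    (h : ∀ x, ‖A x‖ ^ 2 + ‖A' x‖ ^ 2 = ‖x‖ ^ 2) :
    ContinuousLinearMap.adjoint A ∘L A + ContinuousLinearMap.adjoint A' ∘L A' =
      ContinuousLinearMap.id ℂ E := by
  refine ContinuousLinearMap.coe_inj.mp ((ext_inner_map _ _).mp fun x ↦ ?_)
  simp only [ContinuousLinearMap.coe_coe, add_apply,
    ContinuousLinearMap.comp_apply, inner_add_left, ContinuousLinearMap.adjoint_inner_left,
    inner_self_eq_norm_sq_to_K, ContinuousLinearMap.id_apply]
  exact_mod_cast h x

theorem norm_sq_add_norm_sq_of_adjoint_comp_add_eq_id {A : E →L[ℂ] F} {A' : E →L[ℂ] N}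
    (h : ContinuousLinearMap.adjoint A ∘L A + ContinuousLinearMap.adjoint A' ∘L A' =
      ContinuousLinearMap.id ℂ E) (x : E) : ‖A x‖ ^ 2 + ‖A' x‖ ^ 2 = ‖x‖ ^ 2 := by
  have := congrArg (fun T : E →L[ℂ] E ↦ RCLike.re (inner ℂ x (T x))) h
  simpa only [add_apply, ContinuousLinearMap.comp_apply, inner_add_right,
    map_add, re_inner_adjoint_comp_self, ContinuousLinearMap.id_apply,
    inner_self_eq_norm_sq] using this

omit [CompleteSpace W] in
/-- The infimum that defines the range norm is attained. -/
theorem exists_norm_eq_rangeNorm (C : M →L[ℂ] W) {x : W} (hx : x ∈ Set.range C) :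
    ∃ m, C m = x ∧ ‖m‖ = rangeNorm C x ∧ ∀ y, C y = x → ‖m‖ ≤ ‖y‖ := by
  obtain ⟨y₀, rfl⟩ := hx
  -- The preimage of least norm is the component orthogonal to the kernel.
  let Y := (LinearMap.ker C.toLinearMap)ᗮ
  have hker : ∀ z, C (Y.starProjection z) = C z := fun z ↦ by
    have h1 : z - Y.starProjection z ∈ Yᗮ := Y.sub_starProjection_mem_orthogonal z
    have : CompleteSpace (LinearMap.ker C.toLinearMap) := C.isClosed_ker.completeSpace_coe
    rw [Submodule.orthogonal_orthogonal] at h1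
    have h2 : C (z - Y.starProjection z) = 0 := h1
    rw [map_sub, sub_eq_zero] at h2
    exact h2.symm
  have hmin : ∀ y, C y = C y₀ → ‖Y.starProjection y₀‖ ≤ ‖y‖ := fun y hy ↦ by
    have h1 : Y.starProjection (y - y₀) = 0 := by
      rw [Submodule.starProjection_apply_eq_zero_iff]
      refine Submodule.le_orthogonal_orthogonal _ ?_
      change C (y - y₀) = 0
      rw [map_sub, hy, sub_self]
    rw [map_sub, sub_eq_zero] at h1
    rw [← h1]
    exact Y.norm_starProjection_apply_le y
  refine ⟨Y.starProjection y₀, hker y₀, ?_, hmin⟩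
  refine (IsLeast.csInf_eq (s := {r : ℝ | ∃ y : M, C y = C y₀ ∧ ‖y‖ = r})
    ⟨⟨_, hker y₀, rfl⟩, ?_⟩).symm
  rintro _ ⟨y, hy, rfl⟩
  exact hmin y hy

omit [CompleteSpace W] in
theorem rangeNorm_le (C : M →L[ℂ] W) (m : M) : rangeNorm C (C m) ≤ ‖m‖ := by
  obtain ⟨m', -, h, hm⟩ := exists_norm_eq_rangeNorm C ⟨m, rfl⟩
  rw [← h]
  exact hm m rfl

-- Off the range the infimum is over the empty set, hence `0` by convention, so `x` may be
-- arbitrary.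
omit [CompleteSpace M] [CompleteSpace W] in
theorem rangeNorm_nonneg (C : M →L[ℂ] W) (x : W) : 0 ≤ rangeNorm C x := by
  refine Real.sInf_nonneg ?_
  rintro _ ⟨y, -, rfl⟩
  exact norm_nonneg y

/-- The hypothesis says that the row `R = (C, ι)` is a coisometry. Hence `R^* w` is the unique
shortest preimage of `w`, and its norm is `‖w‖`. -/
theorem isComplementOfRange_of_norm_sq {C : M →L[ℂ] W} {ι : N →L[ℂ] W}
    (h : ∀ w, ‖ContinuousLinearMap.adjoint C w‖ ^ 2 + ‖ContinuousLinearMap.adjoint ι w‖ ^ 2 =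
      ‖w‖ ^ 2) : IsComplementOfRange C ι := by
  have hid : ∀ w, C (ContinuousLinearMap.adjoint C w) + ι (ContinuousLinearMap.adjoint ι w) = w :=
    fun w ↦ by
      have := congrArg (fun T : W →L[ℂ] W ↦ T w) (adjoint_comp_add_eq_id h)
      simpa using this
  -- Pythagoras for `(m, y)` and its projection `R^* R (m, y)`.
  have hsq : ∀ (m : M) (y : N), ‖C m + ι y‖ ^ 2 +
      (‖m - ContinuousLinearMap.adjoint C (C m + ι y)‖ ^ 2 +
        ‖y - ContinuousLinearMap.adjoint ι (C m + ι y)‖ ^ 2) = ‖m‖ ^ 2 + ‖y‖ ^ 2 := fun m y ↦ by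
    rw [norm_sub_sq (𝕜 := ℂ), norm_sub_sq (𝕜 := ℂ), ContinuousLinearMap.adjoint_inner_right,
      ContinuousLinearMap.adjoint_inner_right]
    have h1 := h (C m + ι y)
    have h2 : RCLike.re (inner ℂ (C m) (C m + ι y)) + RCLike.re (inner ℂ (ι y) (C m + ι y)) =
        ‖C m + ι y‖ ^ 2 := by
      rw [← map_add, ← inner_add_left, inner_self_eq_norm_sq]
    linarith
  have hle : ∀ x ∈ Set.range C, ∀ y : N, ‖x + ι y‖ ^ 2 ≤ rangeNorm C x ^ 2 + ‖y‖ ^ 2 := by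
    intro x hx y
    obtain ⟨m, rfl, hm, -⟩ := exists_norm_eq_rangeNorm C hx
    rw [← hm, ← hsq]
    nlinarith [sq_nonneg ‖m - ContinuousLinearMap.adjoint C (C m + ι y)‖,
      sq_nonneg ‖y - ContinuousLinearMap.adjoint ι (C m + ι y)‖]
  refine ⟨hle, fun w ↦ ⟨(C (ContinuousLinearMap.adjoint C w), ContinuousLinearMap.adjoint ι w),
    ⟨⟨_, rfl⟩, (hid w).symm, le_antisymm ?_ ?_⟩, ?_⟩⟩
  · have := hle (C (ContinuousLinearMap.adjoint C w)) ⟨_, rfl⟩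
      (ContinuousLinearMap.adjoint ι w)
    rwa [hid w] at this
  · rw [← h w]
    have := rangeNorm_le C (ContinuousLinearMap.adjoint C w)
    have h0 := rangeNorm_nonneg C (C (ContinuousLinearMap.adjoint C w))
    gcongr
  · rintro ⟨x, y⟩ ⟨hx, hw, hn⟩
    obtain ⟨m, rfl, hm, -⟩ := exists_norm_eq_rangeNorm C hx
    simp only at hw hn
    have h1 := hsq m y
    rw [← hw, hn, ← hm] at h1
    -- Equality of norms leaves no room for the two defect terms in `hsq`.
    have h2 : m - ContinuousLinearMap.adjoint C w = 0 := by
      rw [← norm_eq_zero, ← sq_eq_zero_iff]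
      nlinarith [sq_nonneg ‖m - ContinuousLinearMap.adjoint C w‖,
        sq_nonneg ‖y - ContinuousLinearMap.adjoint ι w‖]
    have h3 : y - ContinuousLinearMap.adjoint ι w = 0 := by
      rw [← norm_eq_zero, ← sq_eq_zero_iff]
      nlinarith [sq_nonneg ‖m - ContinuousLinearMap.adjoint C w‖,
        sq_nonneg ‖y - ContinuousLinearMap.adjoint ι w‖]
    rw [← sub_eq_zero.mp h2, ← sub_eq_zero.mp h3]

/-- Let `s = ‖C^* w‖² + ‖ι^* w‖²` and `R = (C, ι)`. Expanding `‖R R^* w - w‖² ≥ 0` with the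
contractivity of `R` gives `s ≤ ‖w‖²`. Expanding `‖(m, y) - R^* w‖² ≥ 0` for the optimal
decomposition `w = C m + ι y` gives `s ≥ ‖w‖²`. -/
theorem IsComplementOfRange.norm_sq {C : M →L[ℂ] W} {ι : N →L[ℂ] W}
    (h : IsComplementOfRange C ι) (w : W) :
    ‖ContinuousLinearMap.adjoint C w‖ ^ 2 + ‖ContinuousLinearMap.adjoint ι w‖ ^ 2 = ‖w‖ ^ 2 := by
  set a := ContinuousLinearMap.adjoint C w with ha
  set b := ContinuousLinearMap.adjoint ι w with hb
  have hab : ‖a‖ ^ 2 + ‖b‖ ^ 2 = RCLike.re (inner ℂ (C a + ι b) w) := by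
    rw [inner_add_left, map_add, ← ContinuousLinearMap.adjoint_inner_right C,
      ← ContinuousLinearMap.adjoint_inner_right ι, ← ha, ← hb, inner_self_eq_norm_sq,
      inner_self_eq_norm_sq]
  have hle : ‖C a + ι b‖ ^ 2 ≤ ‖a‖ ^ 2 + ‖b‖ ^ 2 := by
    refine (h.norm_add_sq_le (C a) ⟨a, rfl⟩ b).trans ?_
    have := rangeNorm_le C a
    have h0 := rangeNorm_nonneg C (C a)
    gcongr
  obtain ⟨⟨x, y⟩, ⟨hx, hw, hn⟩, -⟩ := h.existsUnique_decomposition w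
  obtain ⟨m, rfl, hm, -⟩ := exists_norm_eq_rangeNorm C hx
  simp only at hw hn
  rw [← hm] at hn
  have hmy : RCLike.re (inner ℂ m a) + RCLike.re (inner ℂ y b) = ‖w‖ ^ 2 := by
    rw [ha, hb, ContinuousLinearMap.adjoint_inner_right, ContinuousLinearMap.adjoint_inner_right,
      ← map_add, ← inner_add_left, ← hw, inner_self_eq_norm_sq]
  have h1 : 0 ≤ ‖m - a‖ ^ 2 := sq_nonneg _
  have h2 : 0 ≤ ‖y - b‖ ^ 2 := sq_nonneg _
  have h3 : 0 ≤ ‖C a + ι b - w‖ ^ 2 := sq_nonneg _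
  rw [norm_sub_sq (𝕜 := ℂ)] at h1 h2 h3
  linarith

end HilbertOperators

/-! ### Calculus of operators on Hilbert space tensor products. -/

section HilbertTensor

variable {E F E' F' E'' F'' W : Type*}
  [NormedAddCommGroup E] [InnerProductSpace ℂ E]
  [NormedAddCommGroup F] [InnerProductSpace ℂ F]
  [NormedAddCommGroup E'] [InnerProductSpace ℂ E']
  [NormedAddCommGroup F'] [InnerProductSpace ℂ F']
  [NormedAddCommGroup E''] [InnerProductSpace ℂ E'']
  [NormedAddCommGroup F''] [InnerProductSpace ℂ F'']
  [NormedAddCommGroup W] [InnerProductSpace ℂ W]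

theorem htmul_add (x : E) (y y' : F) : htmul x (y + y') = htmul x y + htmul x y' := by
  rw [htmul, TensorProduct.tmul_add, map_add, htmul, htmul]

theorem add_htmul (x x' : E) (y : F) : htmul (x + x') y = htmul x y + htmul x' y := by
  rw [htmul, TensorProduct.add_tmul, map_add, htmul, htmul]

theorem HilbertTensor.clm_ext {S T : E ⊗ₕ F →L[ℂ] W}
    (h : ∀ x y, S (htmul x y) = T (htmul x y)) : S = T := by
  have hS := HilbertTensor.eq_top (LinearMap.ker (S - T).toLinearMap) (S - T).isClosed_ker
    fun x y ↦ by
      change S (htmul x y) - T (htmul x y) = 0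
      rw [h, sub_self]
  ext z
  have hz : z ∈ LinearMap.ker (S - T).toLinearMap := hS ▸ Submodule.mem_top
  exact sub_eq_zero.mp hz

theorem hmap_comp_hmap (f : E' →L[ℂ] E'') (g : F' →L[ℂ] F'') (f' : E →L[ℂ] E') (g' : F →L[ℂ] F') :
    hmap f g ∘L hmap f' g' = hmap (f ∘L f') (g ∘L g') :=
  HilbertTensor.clm_ext fun x y ↦ by simp [hmap_htmul]

theorem hmap_add_right (f : E →L[ℂ] E') (g g' : F →L[ℂ] F') :
    hmap f (g + g') = hmap f g + hmap f g' :=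
  HilbertTensor.clm_ext fun x y ↦ by simp [hmap_htmul, htmul_add]

theorem hmap_add_left (f f' : E →L[ℂ] E') (g : F →L[ℂ] F') :
    hmap (f + f') g = hmap f g + hmap f' g :=
  HilbertTensor.clm_ext fun x y ↦ by simp [hmap_htmul, add_htmul]

theorem hmap_id : hmap (ContinuousLinearMap.id ℂ E) (ContinuousLinearMap.id ℂ F) =
    ContinuousLinearMap.id ℂ (E ⊗ₕ F) :=
  HilbertTensor.clm_ext fun x y ↦ by simp [hmap_htmul]

theorem norm_hmap_apply_le (f : E →L[ℂ] E') (g : F →L[ℂ] F') (hf : ‖f‖ ≤ 1) (hg : ‖g‖ ≤ 1)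
    (z : E ⊗ₕ F) : ‖hmap f g z‖ ≤ ‖z‖ := by
  refine HilbertTensor.denseRange_incl.induction_on (p := fun z ↦ ‖hmap f g z‖ ≤ ‖z‖) z
    (isClosed_le (by fun_prop) (by fun_prop)) fun z ↦ ?_
  rw [hmap, HilbertTensor.lift_incl, LinearIsometry.norm_map]
  have h1 : ‖HilbertTensor.incl E' F' (TensorProduct.mapL f g z)‖ = ‖TensorProduct.mapL f g z‖ :=
    LinearIsometry.norm_map _ _
  refine h1.trans_le ((ContinuousLinearMap.le_opNorm _ z).trans ?_)
  have h2 : ‖TensorProduct.mapL f g‖ ≤ 1 :=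
    (TensorProduct.norm_mapL_le f g).trans (mul_le_one₀ hf (norm_nonneg g) hg)
  exact mul_le_of_le_one_left (norm_nonneg z) h2

theorem adjoint_hmap [CompleteSpace E] [CompleteSpace F] [CompleteSpace E'] [CompleteSpace F']
    (f : E →L[ℂ] E') (g : F →L[ℂ] F') : ContinuousLinearMap.adjoint (hmap f g) =
      hmap (ContinuousLinearMap.adjoint f) (ContinuousLinearMap.adjoint g) :=
  HilbertTensor.clm_ext fun x' y' ↦ HilbertTensor.ext_inner_htmul fun x y ↦ by
    rw [ContinuousLinearMap.adjoint_inner_left, hmap_htmul, hmap_htmul, inner_htmul, inner_htmul,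
      ContinuousLinearMap.adjoint_inner_left, ContinuousLinearMap.adjoint_inner_left]

theorem adjoint_hswap : ContinuousLinearMap.adjoint (hswap E F) = hswap F E :=
  HilbertTensor.clm_ext fun y x ↦ HilbertTensor.ext_inner_htmul fun x' y' ↦ by
    rw [ContinuousLinearMap.adjoint_inner_left, hswap_htmul, hswap_htmul, inner_htmul, inner_htmul,
      mul_comm]

theorem hswap_hswap (z : E ⊗ₕ F) : hswap F E (hswap E F z) = z := by
  have : hswap F E ∘L hswap E F = ContinuousLinearMap.id ℂ (E ⊗ₕ F) :=
    HilbertTensor.clm_ext fun x y ↦ by simp [hswap_htmul]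
  exact congrArg (fun T : E ⊗ₕ F →L[ℂ] E ⊗ₕ F ↦ T z) this

theorem norm_hswap (z : E ⊗ₕ F) : ‖hswap E F z‖ = ‖z‖ := by
  rw [← sq_eq_sq₀ (norm_nonneg _) (norm_nonneg _), ← inner_self_eq_norm_sq (𝕜 := ℂ),
    ← ContinuousLinearMap.adjoint_inner_left, adjoint_hswap, hswap_hswap, inner_self_eq_norm_sq]

end HilbertTensor

/-! ### Tensoring with a fixed vector or with an identity. -/

section SimpleTensors

variable {E F E' F' B : Type*}
  [NormedAddCommGroup E] [InnerProductSpace ℂ E]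
  [NormedAddCommGroup F] [InnerProductSpace ℂ F]
  [NormedAddCommGroup E'] [InnerProductSpace ℂ E']
  [NormedAddCommGroup F'] [InnerProductSpace ℂ F']
  [NormedAddCommGroup B] [InnerProductSpace ℂ B]

theorem norm_htmul (x : E) (y : F) : ‖htmul x y‖ = ‖x‖ * ‖y‖ := by
  rw [htmul, LinearIsometry.norm_map, TensorProduct.norm_tmul]

/-- The operator `y ↦ x ⊗ y`. -/
noncomputable def htmulLeft (F : Type*) [NormedAddCommGroup F] [InnerProductSpace ℂ F] (x : E) :
    F →L[ℂ] E ⊗ₕ F :=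
  LinearMap.mkContinuous
    { toFun := htmul x
      map_add' := htmul_add x
      map_smul' := fun a y ↦ htmul_smul a x y } ‖x‖ fun y ↦ (norm_htmul x y).le

@[simp]
theorem htmulLeft_apply (x : E) (y : F) : htmulLeft F x y = htmul x y := rfl

theorem adjoint_htmulLeft_htmul [CompleteSpace F] (x x' : E) (y : F) :
    ContinuousLinearMap.adjoint (htmulLeft F x) (htmul x' y) = inner ℂ x x' • y := by
  refine ext_inner_right ℂ fun z ↦ ?_
  rw [ContinuousLinearMap.adjoint_inner_left, htmulLeft_apply, inner_htmul, inner_smul_left,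
    inner_conj_symm]

/-- A pointwise norm identity cannot be tensored directly; its operator form `A^* A + A'^* A' = I`
can. -/
theorem norm_sq_hmap_id_add [CompleteSpace B] [CompleteSpace E] [CompleteSpace F] [CompleteSpace F']
    {A : E →L[ℂ] F} {A' : E →L[ℂ] F'} (h : ∀ x, ‖A x‖ ^ 2 + ‖A' x‖ ^ 2 = ‖x‖ ^ 2) (z : B ⊗ₕ E) :
    ‖hmap (ContinuousLinearMap.id ℂ B) A z‖ ^ 2 + ‖hmap (ContinuousLinearMap.id ℂ B) A' z‖ ^ 2 =
      ‖z‖ ^ 2 := by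
  refine norm_sq_add_norm_sq_of_adjoint_comp_add_eq_id ?_ z
  rw [adjoint_hmap, adjoint_hmap, hmap_comp_hmap, hmap_comp_hmap, ContinuousLinearMap.adjoint_id,
    ContinuousLinearMap.id_comp, ← hmap_add_right, adjoint_comp_add_eq_id h, hmap_id]

end SimpleTensors

/-! ### Totality of the kernel vectors. -/

section KernelFunctions

variable {Λ : Type*} {H : Type*} [NormedAddCommGroup H] [InnerProductSpace ℂ H] [CompleteSpace H]
  [RKHS ℂ H Λ ℂ] {G W : Type*} [NormedAddCommGroup G] [InnerProductSpace ℂ G]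
  [NormedAddCommGroup W] [InnerProductSpace ℂ W]

theorem inner_repKer_left (l : Λ) (f : H) : inner ℂ (repKer H l) f = f l := by
  simp [repKer]

theorem inner_repKer_repKer {K : Λ → Λ → ℂ} (hH : HasKernel H K) (m l : Λ) :
    inner ℂ (repKer H m) (repKer H l) = K m l := by
  rw [inner_repKer_left, repKer, RKHS.kerFun_apply, hH]

/-- The value of `S^* w` at `l` is `⟪k_l, S^* w⟫ = ⟪S k_l, w⟫`, and elements of `H` are determined
by their values. -/
theorem clm_ext_repKer [CompleteSpace W] {S T : H →L[ℂ] W}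
    (h : ∀ l, S (repKer H l) = T (repKer H l)) : S = T := by
  refine ContinuousLinearMap.adjoint.injective (ContinuousLinearMap.ext fun w ↦ RKHS.ext fun l ↦ ?_)
  rw [← inner_repKer_left, ← inner_repKer_left, ContinuousLinearMap.adjoint_inner_right,
    ContinuousLinearMap.adjoint_inner_right, h]

theorem clm_ext_htmul_repKer [CompleteSpace W] {S T : H ⊗ₕ G →L[ℂ] W}
    (h : ∀ l g, S (htmul (repKer H l) g) = T (htmul (repKer H l) g)) : S = T := by
  refine HilbertTensor.clm_ext fun x y ↦ ?_
  have : S ∘L hswap G H ∘L htmulLeft H y = T ∘L hswap G H ∘L htmulLeft H y :=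
    clm_ext_repKer fun l ↦ by simp [hswap_htmul, h]
  simpa [hswap_htmul] using congrArg (fun R : H →L[ℂ] W ↦ R x) this

theorem span_htmul_repKer_dense :
    (Submodule.span ℂ (Set.range fun p : Λ × G ↦ htmul (repKer H p.1) p.2)).topologicalClosure =
      ⊤ := by
  rw [Submodule.topologicalClosure_eq_top_iff, Submodule.eq_bot_iff]
  intro w hw
  have : innerSL ℂ w = 0 := clm_ext_htmul_repKer fun l g ↦ by
    have := (Submodule.mem_orthogonal' _ w).mp hw _ (Submodule.subset_span ⟨(l, g), rfl⟩)
    simpa using this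
  rw [← inner_self_eq_zero (𝕜 := ℂ)]
  exact congrArg (fun R : H ⊗ₕ G →L[ℂ] ℂ ↦ R w) this

theorem adjoint_multOpSwap_htmul [CompleteSpace G] [CompleteSpace W] {Φ : Λ → W →L[ℂ] G}
    (h : IsMultiplier H Φ) (l : Λ) (g : G) :
    ContinuousLinearMap.adjoint (multOpSwap H Φ) (htmul (repKer H l) g) =
      htmul (ContinuousLinearMap.adjoint (Φ l) g) (repKer H l) := by
  rw [multOpSwap, ContinuousLinearMap.adjoint_comp, adjoint_hswap, ContinuousLinearMap.comp_apply,
    hswap_htmul, adjoint_multOp H h]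

end KernelFunctions

/-! ### The identity `𝐁 𝐁^* + π = I` and its tensored forms. -/

section PickOperators

variable {Λ : Type*} {H : Type*} [NormedAddCommGroup H] [InnerProductSpace ℂ H] [CompleteSpace H]
  [RKHS ℂ H Λ ℂ]

theorem IsNormalizedAt.norm_normalizedKer {o : Λ} (ho : IsNormalizedAt H o) :
    ‖normalizedKer H o‖ = 1 := by
  -- If the norm were `0`, the convention `0⁻¹ = 0` would make `δ` zero, against `δ(o) = 1`.
  have h0 : ‖repKer H o‖ ≠ 0 := fun h ↦ by
    have := ho o
    rw [normalizedKer, h] at this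
    simp at this
  rw [normalizedKer, norm_smul]
  simp [h0]

theorem IsNormalizedAt.inner_normalizedKer_repKer {o : Λ} (ho : IsNormalizedAt H o) (l : Λ) :
    inner ℂ (normalizedKer H o) (repKer H l) = 1 := by
  rw [← inner_conj_symm, inner_repKer_left, ho, map_one]

theorem IsNormalizedAt.baseProj_apply {o : Λ} (ho : IsNormalizedAt H o) (f : H) :
    baseProj H o f = inner ℂ (normalizedKer H o) f • normalizedKer H o :=
  Submodule.starProjection_unit_singleton ℂ ho.norm_normalizedKer f

variable {B : Type*} [NormedAddCommGroup B] [InnerProductSpace ℂ B]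
  {K : Λ → Λ → ℂ} {o : Λ} {β : Λ → B}

theorem IsPickRepresentation.sub_inner_mul_eq_one
    (hβ : IsPickRepresentation K (normalizedKer H o) β) (ho : IsNormalizedAt H o) (m l : Λ) :
    (1 - inner ℂ (β m) (β l)) * K m l = 1 := by
  have hne : 1 - inner ℂ (β m) (β l) ≠ 0 := fun h ↦ by
    have h1 : ‖inner ℂ (β m) (β l)‖ ≤ ‖β m‖ * ‖β l‖ := norm_inner_le_norm _ _
    rw [← sub_eq_zero.mp h, norm_one] at h1
    nlinarith [hβ.norm_lt_one m, hβ.norm_lt_one l, norm_nonneg (β m), norm_nonneg (β l)]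
  rw [hβ.kernel_eq, ho, ho, map_one, mul_one, mul_one_div_cancel hne]

variable [CompleteSpace B]

/-- Between `k_m` and `k_l` the three operators have matrix entries `⟪β m, β l⟫ K m l`, `1` and `K m
l`, so this is the Pick representation cleared of its denominator. -/
theorem pickOp_comp_adjoint_add_baseProj (hH : HasKernel H K) (ho : IsNormalizedAt H o)
    (hβ : IsPickRepresentation K (normalizedKer H o) β) :
    pickOp H β ∘L ContinuousLinearMap.adjoint (pickOp H β) + baseProj H o =
      ContinuousLinearMap.id ℂ H := by
  refine clm_ext_repKer fun l ↦ RKHS.ext fun m ↦ ?_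
  rw [← inner_repKer_left, ← inner_repKer_left, add_apply, inner_add_right,
    ContinuousLinearMap.comp_apply, ← ContinuousLinearMap.adjoint_inner_left,
    adjoint_pickOp_repKer H hH hβ, adjoint_pickOp_repKer H hH hβ, inner_htmul,
    inner_repKer_repKer hH, ho.baseProj_apply, ho.inner_normalizedKer_repKer, one_smul,
    inner_repKer_left, ho, ContinuousLinearMap.id_apply, inner_repKer_repKer hH,
    ← hβ.sub_inner_mul_eq_one ho m l]
  ring

variable {G : Type*} [NormedAddCommGroup G] [InnerProductSpace ℂ G] [CompleteSpace G]

theorem adjoint_pickOpTensor :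
    ContinuousLinearMap.adjoint (pickOpTensor H G β) = pickOpAdjointTensor H G β := by
  refine ContinuousLinearMap.ext fun w ↦ ext_inner_right ℂ fun v ↦ ?_
  rw [ContinuousLinearMap.adjoint_inner_left]
  change inner ℂ w (hmap (pickOp H β) (ContinuousLinearMap.id ℂ G) ((hassoc B H G).symm v)) =
    inner ℂ (hassoc B H G (hmap (ContinuousLinearMap.adjoint (pickOp H β))
      (ContinuousLinearMap.id ℂ G) w)) v
  rw [LinearIsometryEquiv.inner_map_eq_flip, ← ContinuousLinearMap.adjoint_inner_left, adjoint_hmap,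
    ContinuousLinearMap.adjoint_id]

omit [CompleteSpace G] in
theorem pickOpAdjointTensor_htmul (hH : HasKernel H K) {δ : Λ → ℂ}
    (hβ : IsPickRepresentation K δ β) (l : Λ) (g : G) :
    pickOpAdjointTensor H G β (htmul (repKer H l) g) = htmul (β l) (htmul (repKer H l) g) := by
  change hassoc B H G (hmap _ _ _) = _
  rw [hmap_htmul, adjoint_pickOp_repKer H hH hβ, ContinuousLinearMap.id_apply, hassoc_htmul]

/-- Replacing the projection by `Q Q^*`, with `Q` isometric, makes `G` itself a summand of the
coefficient space. -/
theorem IsNormalizedAt.baseProjTensor_eq (ho : IsNormalizedAt H o) :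
    baseProjTensor H G o = htmulLeft G (normalizedKer H o) ∘L
      ContinuousLinearMap.adjoint (htmulLeft G (normalizedKer H o)) :=
  HilbertTensor.clm_ext fun x y ↦ by
    rw [baseProjTensor, hmap_htmul, ho.baseProj_apply, ContinuousLinearMap.id_apply, smul_htmul,
      ContinuousLinearMap.comp_apply, adjoint_htmulLeft_htmul, htmulLeft_apply, htmul_smul]

omit [CompleteSpace G] in
theorem IsNormalizedAt.norm_htmulLeft (ho : IsNormalizedAt H o) (g : G) :
    ‖htmulLeft G (normalizedKer H o) g‖ = ‖g‖ := by
  rw [htmulLeft_apply, norm_htmul, ho.norm_normalizedKer, one_mul]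

theorem IsNormalizedAt.norm_baseProjTensor (ho : IsNormalizedAt H o) (w : H ⊗ₕ G) :
    ‖baseProjTensor H G o w‖ =
      ‖ContinuousLinearMap.adjoint (htmulLeft G (normalizedKer H o)) w‖ := by
  rw [ho.baseProjTensor_eq, ContinuousLinearMap.comp_apply, ho.norm_htmulLeft]

theorem IsNormalizedAt.adjoint_htmulLeft_apply (ho : IsNormalizedAt H o) (g : G) :
    ContinuousLinearMap.adjoint (htmulLeft G (normalizedKer H o))
      (htmulLeft G (normalizedKer H o) g) = g := by
  rw [htmulLeft_apply, adjoint_htmulLeft_htmul, inner_self_eq_norm_sq_to_K, ho.norm_normalizedKer]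
  simp

omit [CompleteSpace G] in
theorem pickOpTensor_pickOpAdjointTensor_add (hH : HasKernel H K) (ho : IsNormalizedAt H o)
    (hβ : IsPickRepresentation K (normalizedKer H o) β) (w : H ⊗ₕ G) :
    pickOpTensor H G β (pickOpAdjointTensor H G β w) + baseProjTensor H G o w = w := by
  change hmap _ _ ((hassoc B H G).symm (hassoc B H G (hmap _ _ w))) + hmap _ _ w = w
  rw [LinearIsometryEquiv.symm_apply_apply, ← ContinuousLinearMap.comp_apply, hmap_comp_hmap,
    ← add_apply, ContinuousLinearMap.id_comp, ← hmap_add_left,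
    pickOp_comp_adjoint_add_baseProj hH ho hβ, hmap_id, ContinuousLinearMap.id_apply]

theorem norm_sq_pickOpAdjointTensor_add (hH : HasKernel H K) (ho : IsNormalizedAt H o)
    (hβ : IsPickRepresentation K (normalizedKer H o) β) (w : H ⊗ₕ G) :
    ‖pickOpAdjointTensor H G β w‖ ^ 2 +
      ‖ContinuousLinearMap.adjoint (htmulLeft G (normalizedKer H o)) w‖ ^ 2 = ‖w‖ ^ 2 := by
  refine norm_sq_add_norm_sq_of_adjoint_comp_add_eq_id ?_ w
  ext v
  rw [← adjoint_pickOpTensor, ContinuousLinearMap.adjoint_adjoint, add_apply,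
    ContinuousLinearMap.adjoint_adjoint, ← ho.baseProjTensor_eq, adjoint_pickOpTensor]
  exact pickOpTensor_pickOpAdjointTensor_add hH ho hβ v

theorem norm_pickOpAdjointTensor_le (hH : HasKernel H K) (ho : IsNormalizedAt H o)
    (hβ : IsPickRepresentation K (normalizedKer H o) β) (w : H ⊗ₕ G) :
    ‖pickOpAdjointTensor H G β w‖ ≤ ‖w‖ := by
  refine (sq_le_sq₀ (norm_nonneg _) (norm_nonneg _)).mp ?_
  rw [← norm_sq_pickOpAdjointTensor_add hH ho hβ w]
  exact le_add_of_nonneg_right (sq_nonneg _)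

/-- Since `‖Q^* Q g‖ = ‖Q g‖`, the norm identity leaves nothing for `𝐁^* Q g`. -/
theorem pickOpAdjointTensor_htmulLeft (hH : HasKernel H K) (ho : IsNormalizedAt H o)
    (hβ : IsPickRepresentation K (normalizedKer H o) β) (g : G) :
    pickOpAdjointTensor H G β (htmulLeft G (normalizedKer H o) g) = 0 := by
  have h := norm_sq_pickOpAdjointTensor_add hH ho hβ (htmulLeft G (normalizedKer H o) g)
  rw [ho.adjoint_htmulLeft_apply, ho.norm_htmulLeft] at h
  rw [← norm_eq_zero, ← sq_eq_zero_iff]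
  linarith

theorem adjoint_htmulLeft_pickOpTensor (hH : HasKernel H K) (ho : IsNormalizedAt H o)
    (hβ : IsPickRepresentation K (normalizedKer H o) β) (z : B ⊗ₕ (H ⊗ₕ G)) :
    ContinuousLinearMap.adjoint (htmulLeft G (normalizedKer H o)) (pickOpTensor H G β z) = 0 := by
  refine ext_inner_right ℂ fun g ↦ ?_
  rw [ContinuousLinearMap.adjoint_inner_left, ← ContinuousLinearMap.adjoint_inner_right,
    adjoint_pickOpTensor, pickOpAdjointTensor_htmulLeft hH ho hβ, inner_zero_right,
    inner_zero_left]

variable {N : Type*} [NormedAddCommGroup N] [InnerProductSpace ℂ N] [CompleteSpace N]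

/-! ### The column operator `L`. -/

variable (G) in
/-- The operator `w ↦ ((I ⊗ ι^*) (𝐁^* ⊗ I) w, Q^* w)`, where `Q g = δ ⊗ g`. -/
noncomputable def pickColumn (o : Λ) (β : Λ → B) (ι : N →L[ℂ] H ⊗ₕ G) :
    H ⊗ₕ G →L[ℂ] WithLp 2 ((B ⊗ₕ N) × G) :=
  (WithLp.prodContinuousLinearEquiv 2 ℂ (B ⊗ₕ N) G).symm ∘L
    (((hmap (ContinuousLinearMap.id ℂ B) (ContinuousLinearMap.adjoint ι)) ∘L
      pickOpAdjointTensor H G β).prod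
        (ContinuousLinearMap.adjoint (htmulLeft G (normalizedKer H o))))

theorem inner_pickColumn_left (ι : N →L[ℂ] H ⊗ₕ G) (w : H ⊗ₕ G) (z : WithLp 2 ((B ⊗ₕ N) × G)) :
    inner ℂ (pickColumn G o β ι w) z =
      inner ℂ (hmap (ContinuousLinearMap.id ℂ B) (ContinuousLinearMap.adjoint ι)
        (pickOpAdjointTensor H G β w)) z.fst +
      inner ℂ (ContinuousLinearMap.adjoint (htmulLeft G (normalizedKer H o)) w) z.snd := rfl

/-- This computes `L^*` as `(z₁, z₂) ↦ 𝐁 (I ⊗ ι) z₁ + Q z₂`, the shape of the right side of the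
difference quotient identity. -/
theorem inner_pickColumn_left' (ι : N →L[ℂ] H ⊗ₕ G) (w : H ⊗ₕ G) (z : WithLp 2 ((B ⊗ₕ N) × G)) :
    inner ℂ (pickColumn G o β ι w) z =
      inner ℂ w (pickOpTensor H G β (hmap (ContinuousLinearMap.id ℂ B) ι z.fst) +
        htmulLeft G (normalizedKer H o) z.snd) := by
  rw [inner_pickColumn_left, ContinuousLinearMap.adjoint_inner_left, inner_add_right,
    ← adjoint_pickOpTensor, ← ContinuousLinearMap.adjoint_inner_right,
    ContinuousLinearMap.adjoint_inner_left, adjoint_hmap, ContinuousLinearMap.adjoint_id,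
    ContinuousLinearMap.adjoint_adjoint]

theorem norm_sq_pickColumn (ι : N →L[ℂ] H ⊗ₕ G) (w : H ⊗ₕ G) :
    ‖pickColumn G o β ι w‖ ^ 2 =
      ‖hmap (ContinuousLinearMap.id ℂ B) (ContinuousLinearMap.adjoint ι)
        (pickOpAdjointTensor H G β w)‖ ^ 2 +
      ‖ContinuousLinearMap.adjoint (htmulLeft G (normalizedKer H o)) w‖ ^ 2 :=
  WithLp.prod_norm_sq_eq_of_L2 _

/-! ### From a multiplier to a difference quotient operator. -/

/-- The operator `𝐁^* ⊗ I` commutes with the adjoints of multipliers. -/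
theorem hmap_adjoint_multOpSwap (hH : HasKernel H K) {δ : Λ → ℂ}
    (hβ : IsPickRepresentation K δ β) {G' : Type*} [NormedAddCommGroup G'] [InnerProductSpace ℂ G']
    [CompleteSpace G'] {Φ : Λ → G' →L[ℂ] G} (h : IsMultiplier H Φ) (w : H ⊗ₕ G) :
    hmap (ContinuousLinearMap.id ℂ B) (ContinuousLinearMap.adjoint (multOpSwap H Φ))
        (pickOpAdjointTensor H G β w) =
      hmap (ContinuousLinearMap.id ℂ B) (hswap H G')
        (pickOpAdjointTensor H G' β
          (hswap G' H (ContinuousLinearMap.adjoint (multOpSwap H Φ) w))) := by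
  have : hmap (ContinuousLinearMap.id ℂ B) (ContinuousLinearMap.adjoint (multOpSwap H Φ)) ∘L
      pickOpAdjointTensor H G β = hmap (ContinuousLinearMap.id ℂ B) (hswap H G') ∘L
        pickOpAdjointTensor H G' β ∘L hswap G' H ∘L
          ContinuousLinearMap.adjoint (multOpSwap H Φ) := by
    refine clm_ext_htmul_repKer fun l g ↦ ?_
    simp only [ContinuousLinearMap.comp_apply, pickOpAdjointTensor_htmul hH hβ, hmap_htmul,
      adjoint_multOpSwap_htmul h, hswap_htmul, ContinuousLinearMap.id_apply]
  exact congrArg (fun R : H ⊗ₕ G →L[ℂ] B ⊗ₕ (G' ⊗ₕ H) ↦ R w) this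

theorem norm_hmap_adjoint_multOpSwap_le (hH : HasKernel H K) (ho : IsNormalizedAt H o)
    (hβ : IsPickRepresentation K (normalizedKer H o) β)
    {G' : Type*} [NormedAddCommGroup G'] [InnerProductSpace ℂ G']
    [CompleteSpace G'] {Φ : Λ → G' →L[ℂ] G} (h : IsMultiplier H Φ) (w : H ⊗ₕ G) :
    ‖hmap (ContinuousLinearMap.id ℂ B) (ContinuousLinearMap.adjoint (multOpSwap H Φ))
        (pickOpAdjointTensor H G β w)‖ ≤ ‖ContinuousLinearMap.adjoint (multOpSwap H Φ) w‖ := by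
  rw [hmap_adjoint_multOpSwap hH hβ h]
  refine (norm_hmap_apply_le _ _ ContinuousLinearMap.norm_id_le ?_ _).trans ?_
  · exact ContinuousLinearMap.opNorm_le_bound _ zero_le_one fun z ↦ by rw [norm_hswap, one_mul]
  · exact (norm_pickOpAdjointTensor_le hH ho hβ _).trans_eq (norm_hswap _)

theorem exists_isDifferenceQuotient_of_isComplementOfRange (hH : HasKernel H K)
    (ho : IsNormalizedAt H o) (hβ : IsPickRepresentation K (normalizedKer H o) β)
    {G' : Type*} [NormedAddCommGroup G'] [InnerProductSpace ℂ G']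
    [CompleteSpace G'] {Φ : Λ → G' →L[ℂ] G} (h : IsMultiplier H Φ) {ι : N →L[ℂ] H ⊗ₕ G}
    (hι : IsComplementOfRange (multOpSwap H Φ) ι) :
    ∃ Bt : N →L[ℂ] B ⊗ₕ N, IsDifferenceQuotient H o β ι Bt := by
  -- `‖L w‖² = ‖w‖² - ‖(I ⊗ C^*) 𝐁^* w‖²` and `‖ι^* w‖² = ‖w‖² - ‖C^* w‖²`; the commutation compares
  -- the subtracted terms.
  have hle : ∀ w, ‖ContinuousLinearMap.adjoint ι w‖ ≤ ‖pickColumn G o β ι w‖ := fun w ↦ by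
    refine (sq_le_sq₀ (norm_nonneg _) (norm_nonneg _)).mp ?_
    rw [norm_sq_pickColumn]
    have h1 := norm_sq_hmap_id_add hι.norm_sq (pickOpAdjointTensor H G β w)
    have h2 := hι.norm_sq w
    have h3 := norm_sq_pickOpAdjointTensor_add hH ho hβ w
    have h4 := pow_le_pow_left₀ (norm_nonneg _) (norm_hmap_adjoint_multOpSwap_le hH ho hβ h w) 2
    linarith
  obtain ⟨T, hT, hTL⟩ := exists_contraction_comp_eq _ _ hle
  have hT' : ∀ ξ, ‖ContinuousLinearMap.adjoint T ξ‖ ≤ ‖ξ‖ := fun ξ ↦ by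
    have h1 : ‖T‖ ≤ 1 := T.opNorm_le_bound zero_le_one fun z ↦ by rw [one_mul]; exact hT z
    refine ((ContinuousLinearMap.adjoint T).le_opNorm ξ).trans ?_
    rw [LinearIsometryEquiv.norm_map]
    exact mul_le_of_le_one_left (norm_nonneg ξ) h1
  have heq : ∀ ξ, ι ξ = pickOpTensor H G β (hmap (ContinuousLinearMap.id ℂ B) ι
      (ContinuousLinearMap.adjoint T ξ).fst) +
        htmulLeft G (normalizedKer H o) (ContinuousLinearMap.adjoint T ξ).snd := fun ξ ↦ by
    refine ext_inner_left ℂ fun w ↦ ?_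
    rw [← inner_pickColumn_left', ContinuousLinearMap.adjoint_inner_right, hTL,
      ContinuousLinearMap.adjoint_inner_left]
  -- `Q^* 𝐁 = 0` and `Q^* Q = I` force the second component of `T^*` to be `Q^* ι`; the first one
  -- serves as `Bt`.
  have hQ : ∀ ξ, ContinuousLinearMap.adjoint (htmulLeft G (normalizedKer H o)) (ι ξ) =
      (ContinuousLinearMap.adjoint T ξ).snd := fun ξ ↦ by
    rw [heq ξ, map_add, adjoint_htmulLeft_pickOpTensor hH ho hβ, zero_add,
      ho.adjoint_htmulLeft_apply]
  have hsq : ∀ ξ, ‖(ContinuousLinearMap.adjoint T ξ).fst‖ ^ 2 ≤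
      ‖ξ‖ ^ 2 - ‖baseProjTensor H G o (ι ξ)‖ ^ 2 := fun ξ ↦ by
    have h1 := pow_le_pow_left₀ (norm_nonneg _) (hT' ξ) 2
    rw [WithLp.prod_norm_sq_eq_of_L2] at h1
    rw [ho.norm_baseProjTensor, hQ]
    linarith
  refine ⟨WithLp.fstL 2 ℂ (B ⊗ₕ N) G ∘L ContinuousLinearMap.adjoint T, ?_, fun ξ ↦ ?_, hsq⟩
  · refine ContinuousLinearMap.opNorm_le_bound _ zero_le_one fun ξ ↦ ?_
    rw [one_mul]
    refine (sq_le_sq₀ (norm_nonneg _) (norm_nonneg _)).mp ((hsq ξ).trans ?_)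
    exact sub_le_self _ (sq_nonneg _)
  · refine (heq ξ).trans ?_
    rw [ho.baseProjTensor_eq, ← hQ]
    rfl

/-! ### From a difference quotient operator to a multiplier. -/

/-- `T = (Bt, Q^* ι)` is a contraction with `T^* L = ι^*`, so `F = S L` works, where `S` is the
defect operator of `T^*`. -/
theorem IsDifferenceQuotient.exists_inner_eq (ho : IsNormalizedAt H o) {ι : N →L[ℂ] H ⊗ₕ G}
    {Bt : N →L[ℂ] B ⊗ₕ N} (hBt : IsDifferenceQuotient H o β ι Bt) :
    ∃ F : H ⊗ₕ G →L[ℂ] WithLp 2 ((B ⊗ₕ N) × G), ∀ x y, inner ℂ (F x) (F y) =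
      inner ℂ (pickColumn G o β ι x) (pickColumn G o β ι y) -
        inner ℂ (ContinuousLinearMap.adjoint ι x) (ContinuousLinearMap.adjoint ι y) := by
  let T : N →L[ℂ] WithLp 2 ((B ⊗ₕ N) × G) :=
    (WithLp.prodContinuousLinearEquiv 2 ℂ (B ⊗ₕ N) G).symm ∘L
      (Bt.prod (ContinuousLinearMap.adjoint (htmulLeft G (normalizedKer H o)) ∘L ι))
  have hT : ‖T‖ ≤ 1 := T.opNorm_le_bound zero_le_one fun ξ ↦ by
    rw [one_mul]
    refine (sq_le_sq₀ (norm_nonneg _) (norm_nonneg _)).mp ?_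
    have h1 : ‖T ξ‖ ^ 2 = ‖Bt ξ‖ ^ 2 +
        ‖ContinuousLinearMap.adjoint (htmulLeft G (normalizedKer H o)) (ι ξ)‖ ^ 2 :=
      WithLp.prod_norm_sq_eq_of_L2 _
    have h2 := hBt.norm_sq_le ξ
    rw [ho.norm_baseProjTensor] at h2
    linarith
  have hTL : ∀ w, ContinuousLinearMap.adjoint T (pickColumn G o β ι w) =
      ContinuousLinearMap.adjoint ι w := fun w ↦ by
    refine ext_inner_right ℂ fun ξ ↦ ?_
    rw [ContinuousLinearMap.adjoint_inner_left, ContinuousLinearMap.adjoint_inner_left,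
      inner_pickColumn_left', hBt.eq_add ξ, ho.baseProjTensor_eq]
    rfl
  obtain ⟨S, hS⟩ := exists_defect_operator (ContinuousLinearMap.adjoint T) fun z ↦ by
    refine ((ContinuousLinearMap.adjoint T).le_opNorm z).trans ?_
    rw [LinearIsometryEquiv.norm_map]
    exact mul_le_of_le_one_left (norm_nonneg z) hT
  refine ⟨S ∘L pickColumn G o β ι, fun x y ↦ ?_⟩
  rw [ContinuousLinearMap.comp_apply, ContinuousLinearMap.comp_apply, hS, hTL, hTL]

theorem IsDifferenceQuotient.exists_isContractiveMultiplier (hH : HasKernel H K)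
    (ho : IsNormalizedAt H o) (hβ : IsPickRepresentation K (normalizedKer H o) β)
    {ι : N →L[ℂ] H ⊗ₕ G} {Bt : N →L[ℂ] B ⊗ₕ N} (hBt : IsDifferenceQuotient H o β ι Bt) :
    ∃ Φ : Λ → WithLp 2 ((B ⊗ₕ N) × G) →L[ℂ] G,
      IsContractiveMultiplier H Φ ∧ IsComplementOfRange (multOpSwap H Φ) ι := by
  obtain ⟨F, hF⟩ := hBt.exists_inner_eq ho
  let Φ : Λ → WithLp 2 ((B ⊗ₕ N) × G) →L[ℂ] G := fun l ↦
    ContinuousLinearMap.adjoint (F ∘L htmulLeft G (repKer H l))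
  have hΦ : ∀ l g, ContinuousLinearMap.adjoint (Φ l) g = F (htmul (repKer H l) g) := fun l g ↦ by
    rw [ContinuousLinearMap.adjoint_adjoint]
    rfl
  obtain ⟨T, hT, hsq⟩ := exists_extension_of_inner_eq
    (fun p : Λ × G ↦ htmul (repKer H p.1) p.2)
    (fun p : Λ × G ↦ htmul (ContinuousLinearMap.adjoint (Φ p.1) p.2) (repKer H p.1))
    (ContinuousLinearMap.adjoint ι) span_htmul_repKer_dense fun p q ↦ by
      rw [hΦ, hΦ, inner_htmul, hF, inner_pickColumn_left, inner_htmul, inner_repKer_repKer hH]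
      change (inner ℂ (hmap _ _ (pickOpAdjointTensor H G β _))
        (hmap _ _ (pickOpAdjointTensor H G β _)) +
          inner ℂ _ (ContinuousLinearMap.adjoint (htmulLeft G (normalizedKer H o)) _) - _) * _ = _
      rw [pickOpAdjointTensor_htmul hH hβ, pickOpAdjointTensor_htmul hH hβ, hmap_htmul, hmap_htmul,
        inner_htmul, adjoint_htmulLeft_htmul, adjoint_htmulLeft_htmul,
        ho.inner_normalizedKer_repKer, ho.inner_normalizedKer_repKer, one_smul, one_smul,
        ContinuousLinearMap.id_apply, ContinuousLinearMap.id_apply]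
      -- The coefficient of the `ι^*` term is `-(1 - ⟪β m, β l⟫) K m l = -1`.
      linear_combination (-inner ℂ (ContinuousLinearMap.adjoint ι (htmul (repKer H p.1) p.2))
        (ContinuousLinearMap.adjoint ι (htmul (repKer H q.1) q.2))) *
          hβ.sub_inner_mul_eq_one ho p.1 q.1
  have hmult : IsContractiveMultiplier H Φ := by
    refine ⟨T ∘L hswap G H, fun l g ↦ ?_, ?_⟩
    · rw [ContinuousLinearMap.comp_apply, hswap_htmul]
      exact hT (l, g)
    · refine ContinuousLinearMap.opNorm_le_bound _ zero_le_one fun z ↦ ?_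
      rw [one_mul, ContinuousLinearMap.comp_apply, ← norm_hswap z]
      refine (sq_le_sq₀ (norm_nonneg _) (norm_nonneg _)).mp ?_
      rw [← hsq]
      exact le_add_of_nonneg_right (sq_nonneg _)
  refine ⟨Φ, hmult, isComplementOfRange_of_norm_sq fun w ↦ ?_⟩
  have hadj : ContinuousLinearMap.adjoint (multOpSwap H Φ) = T := by
    obtain ⟨R, hR, -⟩ := hmult
    refine clm_ext_htmul_repKer fun l g ↦ ?_
    rw [adjoint_multOpSwap_htmul ⟨R, hR⟩]
    exact (hT (l, g)).symm
  rw [hadj, hsq]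

-- With `x = (I ⊗ ι) Bt ξ` and `y = 𝐁^* ι ξ`, the equality `𝐁 x = 𝐁 y` gives `Re ⟪x, y⟫ = ‖y‖²`. The
-- bound `‖x‖ ≤ ‖y‖`, where `ι` isometric enters, then yields `‖x - y‖² = ‖x‖² - ‖y‖² ≤ 0`.
omit [CompleteSpace N] in
theorem IsDifferenceQuotient.eq_pickOpAdjointTensor (hH : HasKernel H K)
    (ho : IsNormalizedAt H o) (hβ : IsPickRepresentation K (normalizedKer H o) β)
    {ι : N →L[ℂ] H ⊗ₕ G} (hι : ∀ ξ, ‖ι ξ‖ = ‖ξ‖) {Bt : N →L[ℂ] B ⊗ₕ N}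
    (hBt : IsDifferenceQuotient H o β ι Bt) (ξ : N) :
    hmap (ContinuousLinearMap.id ℂ B) ι (Bt ξ) = pickOpAdjointTensor H G β (ι ξ) := by
  set x := hmap (ContinuousLinearMap.id ℂ B) ι (Bt ξ) with hx
  have h1 : ‖x‖ ≤ ‖Bt ξ‖ := norm_hmap_apply_le _ _ ContinuousLinearMap.norm_id_le
    (ι.opNorm_le_bound zero_le_one fun z ↦ by rw [one_mul, hι]) _
  have h2 := hBt.norm_sq_le ξ
  have h3 : pickOpTensor H G β x = pickOpTensor H G β (pickOpAdjointTensor H G β (ι ξ)) :=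
    add_right_cancel ((hBt.eq_add ξ).symm.trans
      (pickOpTensor_pickOpAdjointTensor_add hH ho hβ (ι ξ)).symm)
  have h4 := norm_sq_pickOpAdjointTensor_add hH ho hβ (ι ξ)
  have h5 : RCLike.re (inner ℂ x (pickOpAdjointTensor H G β (ι ξ))) =
      ‖pickOpAdjointTensor H G β (ι ξ)‖ ^ 2 := by
    rw [← inner_self_eq_norm_sq (𝕜 := ℂ), ← adjoint_pickOpTensor,
      ContinuousLinearMap.adjoint_inner_right, ContinuousLinearMap.adjoint_inner_right,
      adjoint_pickOpTensor, h3]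
  rw [ho.norm_baseProjTensor, ← hι] at h2
  rw [← sub_eq_zero, ← norm_eq_zero, ← sq_eq_zero_iff]
  refine le_antisymm ?_ (sq_nonneg _)
  rw [norm_sub_sq (𝕜 := ℂ), h5]
  nlinarith [norm_nonneg x]

end PickOperators

/-! ### The theorem. -/

theorem mainTheorem2 {Λ : Type*} {H : Type*} [NormedAddCommGroup H] [InnerProductSpace ℂ H]
    [CompleteSpace H] [RKHS ℂ H Λ ℂ] (K : Λ → Λ → ℂ) (hK : IsPickKernel K) (hH : HasKernel H K)
    (o : Λ) (ho : IsNormalizedAt H o)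
    {B : Type uB} [NormedAddCommGroup B] [InnerProductSpace ℂ B] [CompleteSpace B]
    (β : Λ → B) (hβ : IsPickRepresentation K (normalizedKer H o) β)
    {G : Type uG} [NormedAddCommGroup G] [InnerProductSpace ℂ G] [CompleteSpace G]
    {N : Type uN} [NormedAddCommGroup N] [InnerProductSpace ℂ N] [CompleteSpace N]
    (ι : N →L[ℂ] H ⊗ₕ G) (hι : IsContractiveInclusion ι) :
    ((∃ (G' : Type (max uB uG uN)) (_ : NormedAddCommGroup G') (_ : InnerProductSpace ℂ G')
        (_ : CompleteSpace G') (Φ : Λ → G' →L[ℂ] G),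
        IsContractiveMultiplier H Φ ∧ IsComplementOfRange (multOpSwap H Φ) ι) ↔
      ∃ Bt : N →L[ℂ] B ⊗ₕ N, IsDifferenceQuotient H o β ι Bt) ∧
    ((∀ ξ : N, ‖ι ξ‖ = ‖ξ‖) →
      ∀ Bt : N →L[ℂ] B ⊗ₕ N, IsDifferenceQuotient H o β ι Bt →
        ∀ ξ : N, hmap (ContinuousLinearMap.id ℂ B) ι (Bt ξ) = pickOpAdjointTensor H G β (ι ξ)) := by
  refine ⟨⟨?_, ?_⟩, fun hiso Bt hBt ↦ hBt.eq_pickOpAdjointTensor hH ho hβ hiso⟩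
  · rintro ⟨G', _, _, _, Φ, ⟨T, hT, -⟩, hι'⟩
    exact exists_isDifferenceQuotient_of_isComplementOfRange hH ho hβ ⟨T, hT⟩ hι'
  · rintro ⟨Bt, hBt⟩
    -- The coefficient space is `(B ⊗ N) ⊕ G`, which accounts for the universe of `G'`.
    exact ⟨_, _, _, inferInstance, hBt.exists_isContractiveMultiplier hH ho hβ⟩
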